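/- Let $b=3\pi/4$ and define $\theta:[0,\infty)\to\mathbb{R}$ by $\theta(x)=\sin x$ for $0\le x<b$ and $\theta(x)=\frac{e^{3\pi/4}}{\sqrt2}\,e^{-x}$ for $x\ge b$. Let $f$ be the odd extension of $\theta$ to $\mathbb{R}$. Put $$Q_s(x)=-2\,\delta'(x-b)+4\,\delta(x-b),\qquad q_s(x)=Q_s(x)+Q_s(-x)=-2\,\delta'(x-b)+4\,\delta(x-b)+2\,\delta'(x+b)+4\,\delta(x+b),$$ where $\delta$ is the Dirac delta distribution. For a $C^1$ function $u$ the product $q_s u$ is the distribution $\langle q_s u,\varphi\rangle=\langle q_s,u\varphi\rangle$. Let $L$ be the operator $Lu=u''''+q_s u$ in the complex Hilbert space $L^2(\mathbb{R})$ with domain the set of all $u\in L^2(\mathbb{R})$ that have a $C^1$ representative and for which the distribution $u''''+q_s u$ belongs to $L^2(\mathbb{R})$. The continuous spectrum $\sigma_c(L)$ is the set of all $\lambda\in\mathbb{C}$ for which the range of $L-\lambda$ is not closed (so it may contain eigenvalues). Then $\theta\in C^1[0,\infty)$, $f\in C^1(\mathbb{R})\cap L^2(\mathbb{R})$, and $f''''+q_s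 f=f$ on $\mathbb{R}$ in the sense of distributions. Moreover $f$ is an eigenfunction of $L$ (that is, $f\ne0$ in $L^2(\mathbb{R})$, $f$ lies in the domain of $L$, and $Lf=f$) with eigenvalue $1$, and $\sigma_c(L)=[0,\infty)$. Hence the eigenvalue $1$ of $L$ is embedded in the continuous spectrum of $L$. -/

import Mathlib

open MeasureTheory
open scoped ContDiff

noncomputable section

namespace EmbeddedEigenvalue

/-! ### The function `f` -/

/-- `θ(x) = sin x` for `x < 3π/4` and `θ(x) = (e^{3π/4} / √2) e^{-x}` for `x ≥ 3π/4`;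
only its values on `[0, ∞)` matter. -/
def theta (x : ℝ) : ℝ :=
  if x < 3 * Real.pi / 4 then Real.sin x
  else Real.exp (3 * Real.pi / 4) / Real.sqrt 2 * Real.exp (-x)

/-- The odd extension `f` of `θ` from `[0, ∞)` to `ℝ`. -/
def f (x : ℝ) : ℝ := if 0 ≤ x then theta x else -theta (-x)

/-- `f` as a complex-valued function. -/
def fC (x : ℝ) : ℂ := (f x : ℂ)

/-! ### Distributions of order at most one -/

/-- A distribution `T` on `ℝ` is represented by its pairing `ψ ↦ ⟨T, ψ⟩` (bilinear, without
conjugation). The pairings of `δ` and `δ'` below make sense for every `C¹` function `ψ`; they are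
only ever applied to such functions. -/
abbrev Pairing : Type := (ℝ → ℂ) → ℂ

/-- The Dirac distribution `δ(x - b)`: `⟨δ(x - b), ψ⟩ = ψ(b)`. -/
def dirac (b : ℝ) : Pairing := fun ψ => ψ b

/-- Its derivative `δ'(x - b)`: `⟨δ'(x - b), ψ⟩ = -ψ'(b)`. -/
def diracDeriv (b : ℝ) : Pairing := fun ψ => -deriv ψ b

/-- The reflected distribution `T(-x)`: `⟨T(-x), ψ⟩ = ⟨T, ψ(-x)⟩`. -/
def reflect (T : Pairing) : Pairing := fun ψ => T (fun x => ψ (-x))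

/-- The product `T u` of a distribution of order at most one and a `C¹` function `u`:
`⟨T u, φ⟩ = ⟨T, u φ⟩`. -/
def mulFun (T : Pairing) (u : ℝ → ℂ) : Pairing := fun φ => T (fun x => u x * φ x)

/-- The regular distribution given by a locally integrable function `g`. -/
def ofFun (g : ℝ → ℂ) : Pairing := fun φ => ∫ x, g x * φ x

/-- The fourth distributional derivative `u''''` of a locally integrable function `u`. -/
def fourthDeriv (u : ℝ → ℂ) : Pairing := fun φ => ∫ x, u x * iteratedDeriv 4 φ x

/-- Equality of distributions: the pairings agree on all test functions. -/
def DistEq (S T : Pairing) : Prop :=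
  ∀ φ : ℝ → ℂ, ContDiff ℝ ∞ φ → HasCompactSupport φ → S φ = T φ

/-- `Q_s(x) = -2 δ'(x - 3π/4) + 4 δ(x - 3π/4)`. -/
def Qs : Pairing :=
  (-2 : ℂ) • diracDeriv (3 * Real.pi / 4) + (4 : ℂ) • dirac (3 * Real.pi / 4)

/-- The singular potential `q_s(x) = Q_s(x) + Q_s(-x)`, that is
`-2 δ'(x - 3π/4) + 4 δ(x - 3π/4) + 2 δ'(x + 3π/4) + 4 δ(x + 3π/4)`. -/
def qs : Pairing := Qs + reflect Qs

theorem qs_apply (ψ : ℝ → ℂ) :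
    qs ψ = -2 * diracDeriv (3 * Real.pi / 4) ψ + 4 * dirac (3 * Real.pi / 4) ψ
      + 2 * diracDeriv (-(3 * Real.pi / 4)) ψ + 4 * dirac (-(3 * Real.pi / 4)) ψ := by
  simp only [qs, Qs, reflect, dirac, diracDeriv, Pi.add_apply, Pi.smul_apply, smul_eq_mul,
    deriv_comp_neg]
  ring

/-- The distribution `u'''' + q_s u`, for `u` of class `C¹`. -/
def formalL (u : ℝ → ℂ) : Pairing := fourthDeriv u + mulFun qs u

/-! ### The operator `L` in `L²(ℝ)` -/

/-- The complex Hilbert space `L²(ℝ)`. -/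
abbrev L2 : Type := Lp ℂ 2 (volume : Measure ℝ)

theorem integrable_mul_test {u : ℝ → ℂ} (hu : LocallyIntegrable u) {φ : ℝ → ℂ}
    (hφ : Continuous φ) (hc : HasCompactSupport φ) : Integrable (fun x => u x * φ x) := by
  simpa [mul_comm] using hu.integrable_smul_left_of_hasCompactSupport hφ hc

theorem continuous_fourth {φ : ℝ → ℂ} (hφ : ContDiff ℝ ∞ φ) : Continuous (iteratedDeriv 4 φ) :=
  hφ.continuous_iteratedDeriv 4 (WithTop.coe_le_coe.2 (le_top (a := (4 : ℕ∞))))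

theorem hasCompactSupport_fourth {φ : ℝ → ℂ} (hc : HasCompactSupport φ) :
    HasCompactSupport (iteratedDeriv 4 φ) := by
  simp only [iteratedDeriv_succ, iteratedDeriv_zero]
  exact hc.deriv.deriv.deriv.deriv

theorem L2.locallyIntegrable (g : L2) : LocallyIntegrable (g : ℝ → ℂ) :=
  (Lp.memLp g).locallyIntegrable (by norm_num)

theorem formalL_add {u v : ℝ → ℂ} (hu : ContDiff ℝ 1 u) (hv : ContDiff ℝ 1 v) {φ : ℝ → ℂ}
    (hφ : ContDiff ℝ ∞ φ) (hc : HasCompactSupport φ) :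
    formalL (fun x => u x + v x) φ = formalL u φ + formalL v φ := by
  have h4 := continuous_fourth hφ
  have h4c := hasCompactSupport_fourth hc
  have du : Differentiable ℝ u := hu.differentiable (by norm_num)
  have dv : Differentiable ℝ v := hv.differentiable (by norm_num)
  have dφ : Differentiable ℝ φ := hφ.differentiable (by simp)
  have hd : ∀ b, deriv (fun x => (u x + v x) * φ x) b
      = deriv (fun x => u x * φ x) b + deriv (fun x => v x * φ x) b := by
    intro b
    have : (fun x => (u x + v x) * φ x) = fun x => u x * φ x + v x * φ x := by
      funext x; ring
    rw [this]
    exact deriv_fun_add ((du b).mul (dφ b)) ((dv b).mul (dφ b))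
  simp only [formalL, fourthDeriv, mulFun, Pi.add_apply, qs_apply, dirac, diracDeriv, hd]
  simp only [add_mul]
  rw [integral_add (integrable_mul_test hu.continuous.locallyIntegrable h4 h4c)
    (integrable_mul_test hv.continuous.locallyIntegrable h4 h4c)]
  ring

theorem formalL_smul (c : ℂ) (u φ : ℝ → ℂ) :
    formalL (fun x => c * u x) φ = c * formalL u φ := by
  have hd : ∀ b, deriv (fun x => c * (u x * φ x)) b = c * deriv (fun x => u x * φ x) b :=
    fun b => by simp
  simp only [formalL, fourthDeriv, mulFun, Pi.add_apply, qs_apply, dirac, diracDeriv, mul_assoc,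
    hd, integral_const_mul]
  ring

/-- The graph of `L`: the pairs `(u, g)` in `L²(ℝ) × L²(ℝ)` such that `u` has a `C¹` representative
`v` with `v'''' + q_s v = g` in the sense of distributions. -/
def graphL : Submodule ℂ (L2 × L2) where
  carrier := {p | ∃ v : ℝ → ℂ, ContDiff ℝ 1 v ∧ (p.1 : ℝ → ℂ) =ᵐ[volume] v ∧
    DistEq (formalL v) (ofFun p.2)}
  zero_mem' := by
    refine ⟨fun _ => 0, contDiff_const, Lp.coeFn_zero ℂ 2 volume, fun φ _ _ => ?_⟩
    have h0 : ∫ x, ((0 : L2) : ℝ → ℂ) x * φ x = 0 := by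
      rw [integral_congr_ae (g := fun _ => (0 : ℂ)), integral_zero]
      filter_upwards [Lp.coeFn_zero ℂ 2 (volume : Measure ℝ)] with x hx
      simp
    have := formalL_smul 0 (fun _ => 0) φ
    simp only [zero_mul] at this
    rw [this]
    exact h0.symm
  add_mem' := by
    rintro ⟨u₁, g₁⟩ ⟨u₂, g₂⟩ ⟨v₁, hv₁, ha₁, he₁⟩ ⟨v₂, hv₂, ha₂, he₂⟩
    refine ⟨fun x => v₁ x + v₂ x, hv₁.add hv₂, ?_, fun φ hφ hc => ?_⟩
    · filter_upwards [Lp.coeFn_add u₁ u₂, ha₁, ha₂] with x hx h1 h2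
      simp only [Prod.fst_add] at *
      rw [hx, Pi.add_apply, h1, h2]
    · rw [formalL_add hv₁ hv₂ hφ hc, he₁ φ hφ hc, he₂ φ hφ hc]
      simp only [ofFun]
      rw [← integral_add (integrable_mul_test (L2.locallyIntegrable g₁) hφ.continuous hc)
        (integrable_mul_test (L2.locallyIntegrable g₂) hφ.continuous hc)]
      refine integral_congr_ae ?_
      filter_upwards [Lp.coeFn_add g₁ g₂] with x hx
      simp only [Prod.mk_add_mk] at *
      rw [hx, Pi.add_apply, add_mul]
  smul_mem' := by
    rintro c ⟨u, g⟩ ⟨v, hv, ha, he⟩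
    refine ⟨fun x => c * v x, contDiff_const.mul hv, ?_, fun φ hφ hc => ?_⟩
    · filter_upwards [Lp.coeFn_smul c u, ha] with x hx h1
      simp only [Prod.smul_fst] at *
      rw [hx, Pi.smul_apply, h1, smul_eq_mul]
    · rw [formalL_smul, he φ hφ hc]
      simp only [ofFun]
      rw [← integral_const_mul]
      refine integral_congr_ae ?_
      filter_upwards [Lp.coeFn_smul c g] with x hx
      simp only [Prod.smul_mk] at *
      rw [hx, Pi.smul_apply, smul_eq_mul, mul_assoc]

/-- The graph is single-valued. -/
theorem graphL_single (p : L2 × L2) (hp : p ∈ graphL) (h0 : p.1 = 0) : p.2 = 0 := by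
  obtain ⟨v, hv, ha, he⟩ := hp
  have hv0 : v = fun _ => 0 := by
    refine (Continuous.ae_eq_iff_eq volume hv.continuous continuous_const).1 ?_
    rw [h0] at ha
    exact ha.symm.trans (Lp.coeFn_zero ℂ 2 volume)
  have hz : ∀ᵐ x, (p.2 : ℝ → ℂ) x = 0 := by
    refine ae_eq_zero_of_integral_contDiff_smul_eq_zero (L2.locallyIntegrable p.2)
      fun g hg hgc => ?_
    have hφ : ContDiff ℝ ∞ (fun x => (g x : ℂ)) := Complex.ofRealCLM.contDiff.comp hg
    have hφc : HasCompactSupport (fun x => (g x : ℂ)) :=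
      hgc.comp_left (g := fun r : ℝ => (r : ℂ)) Complex.ofReal_zero
    have h := he _ hφ hφc
    have h00 := formalL_smul 0 (fun _ => 0) (fun x => (g x : ℂ))
    simp only [zero_mul] at h00
    rw [hv0, h00] at h
    rw [h]
    simp only [ofFun, Complex.real_smul, mul_comm]
  exact (Lp.eq_zero_iff_ae_eq_zero).2 hz

/-- The operator `L u = u'''' + q_s u` in `L²(ℝ)`, on its maximal domain: all `u ∈ L²(ℝ)` of class
`C¹` (so that the product `q_s u` is defined) for which the distribution `u'''' + q_s u` belongs to
`L²(ℝ)`. -/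
def L : L2 →ₗ.[ℂ] L2 := graphL.toLinearPMap

theorem mem_graph_L (p : L2 × L2) : p ∈ L.graph ↔
    ∃ v : ℝ → ℂ, ContDiff ℝ 1 v ∧ (p.1 : ℝ → ℂ) =ᵐ[volume] v ∧
      DistEq (formalL v) (ofFun p.2) := by
  rw [L, Submodule.toLinearPMap_graph_eq _ graphL_single]
  rfl

/-! ### Spectral notions for unbounded operators -/

/-- `u` is an eigenvector of the (unbounded) operator `T` with eigenvalue `z`. -/
def IsEigenvector {H : Type*} [NormedAddCommGroup H] [NormedSpace ℂ H]
    (T : H →ₗ.[ℂ] H) (z : ℂ) (u : H) : Prop :=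
  u ≠ 0 ∧ ∃ h : u ∈ T.domain, T ⟨u, h⟩ = z • u

/-- The continuous spectrum of `T`: all `z` for which the range of `T - z` is not closed.
Eigenvalues are not excluded; for a self-adjoint operator whose eigenvalues have finite
multiplicity it is the set of accumulation points of the spectrum. -/
def continuousSpectrum {H : Type*} [NormedAddCommGroup H] [NormedSpace ℂ H]
    (T : H →ₗ.[ℂ] H) : Set ℂ :=
  {z | ¬ IsClosed (Set.range fun u : T.domain => T u - z • (u : H))}

/-- `z` is an eigenvalue of `T` embedded in the continuous spectrum. -/
def IsEmbeddedEigenvalue {H : Type*} [NormedAddCommGroup H] [NormedSpace ℂ H]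
    (T : H →ₗ.[ℂ] H) (z : ℂ) : Prop :=
  (∃ u : H, IsEigenvector T z u) ∧ z ∈ continuousSpectrum T

end EmbeddedEigenvalue

end

noncomputable section

namespace EmbeddedEigenvalue

open Set Filter Topology FourierTransform

/-- Gluing two `C¹` functions whose values and derivatives agree at the junction. -/
theorem contDiff_one_ite_lt {g₁ g₂ : ℝ → ℝ} {a : ℝ} (h₁ : ContDiff ℝ 1 g₁) (h₂ : ContDiff ℝ 1 g₂)
    (h : g₁ a = g₂ a) (h' : deriv g₁ a = deriv g₂ a) :
    ContDiff ℝ 1 (fun x => if x < a then g₁ x else g₂ x) := by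
  have d₁ : Differentiable ℝ g₁ := h₁.differentiable (by norm_num)
  have d₂ : Differentiable ℝ g₂ := h₂.differentiable (by norm_num)
  have key : ∀ x, HasDerivAt (fun x => if x < a then g₁ x else g₂ x)
      (if a ≤ x then deriv g₂ x else deriv g₁ x) x := by
    intro x
    rcases lt_trichotomy x a with hx | rfl | hx
    · rw [if_neg hx.not_ge]
      refine (d₁ x).hasDerivAt.congr_of_eventuallyEq ?_
      filter_upwards [Iio_mem_nhds hx] with y hy
      exact if_pos hy
    · rw [if_pos le_rfl]
      have e₁ : HasDerivWithinAt (fun y => if y < x then g₁ y else g₂ y) (deriv g₂ x) (Iic x) x := by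
        rw [← h']
        refine (d₁ x).hasDerivAt.hasDerivWithinAt.congr (fun y hy => ?_) (by simp [h])
        rcases (mem_Iic.1 hy).lt_or_eq with hy | rfl
        · simp [hy]
        · simp [h]
      have e₂ : HasDerivWithinAt (fun y => if y < x then g₁ y else g₂ y) (deriv g₂ x) (Ici x) x := by
        refine (d₂ x).hasDerivAt.hasDerivWithinAt.congr (fun y hy => ?_) (by simp)
        simp [(mem_Ici.1 hy).not_gt]
      simpa using e₁.union e₂
    · rw [if_pos hx.le]
      refine (d₂ x).hasDerivAt.congr_of_eventuallyEq ?_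
      filter_upwards [Ioi_mem_nhds hx] with y hy
      exact if_neg (not_lt.2 (le_of_lt hy))
  refine contDiff_one_iff_deriv.2 ⟨fun x => (key x).differentiableAt, ?_⟩
  rw [show deriv (fun x => if x < a then g₁ x else g₂ x)
    = fun x => if a ≤ x then deriv g₂ x else deriv g₁ x from funext fun x => (key x).deriv]
  refine Continuous.if_le (h₂.continuous_deriv le_rfl) (h₁.continuous_deriv le_rfl)
    continuous_const continuous_id fun x hx => ?_
  rw [← hx, h']

theorem sin_three_pi_div_four : Real.sin (3 * Real.pi / 4) = √2 / 2 := by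
  rw [show 3 * Real.pi / 4 = Real.pi - Real.pi / 4 by ring, Real.sin_pi_sub, Real.sin_pi_div_four]

theorem cos_three_pi_div_four : Real.cos (3 * Real.pi / 4) = -(√2 / 2) := by
  rw [show 3 * Real.pi / 4 = Real.pi - Real.pi / 4 by ring, Real.cos_pi_sub, Real.cos_pi_div_four]

theorem theta_coeff_mul_exp :
    Real.exp (3 * Real.pi / 4) / √2 * Real.exp (-(3 * Real.pi / 4)) = √2 / 2 := by
  have h2 : √2 * √2 = 2 := Real.mul_self_sqrt (by norm_num)
  have h0 : √2 ≠ 0 := by positivity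
  rw [div_mul_eq_mul_div, ← Real.exp_add, add_neg_cancel, Real.exp_zero]
  field_simp
  linarith

theorem contDiff_theta : ContDiff ℝ 1 theta := by
  refine contDiff_one_ite_lt Real.contDiff_sin (by fun_prop) ?_ ?_
  · rw [sin_three_pi_div_four, theta_coeff_mul_exp]
  · have : HasDerivAt (fun x : ℝ => Real.exp (3 * Real.pi / 4) / √2 * Real.exp (-x))
        (Real.exp (3 * Real.pi / 4) / √2 * (Real.exp (-(3 * Real.pi / 4)) * (-1)))
        (3 * Real.pi / 4) :=
      ((hasDerivAt_neg (3 * Real.pi / 4)).exp).const_mul _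
    rw [Real.deriv_sin, cos_three_pi_div_four, this.deriv, ← theta_coeff_mul_exp]
    ring

theorem theta_zero : theta 0 = 0 := by
  simp [theta, Real.pi_pos]

theorem contDiff_f : ContDiff ℝ 1 f := by
  have : f = fun x => if x < 0 then -theta (-x) else theta x := by
    funext x
    by_cases h : 0 ≤ x
    · simp [f, h, h.not_gt]
    · simp [f, h, not_le.1 h]
  rw [this]
  refine contDiff_one_ite_lt (contDiff_theta.comp contDiff_neg).neg contDiff_theta ?_ ?_
  · simp [theta_zero]
  · have : HasDerivAt (fun x => -theta (-x)) (-(deriv theta (-0) * (-1))) 0 := by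
      have h := ((contDiff_theta.differentiable (by norm_num)) (-0)).hasDerivAt
      exact (HasDerivAt.comp (0 : ℝ) h (hasDerivAt_neg (0 : ℝ))).fun_neg
    rw [this.deriv]
    simp

theorem contDiff_fC : ContDiff ℝ 1 fC := Complex.ofRealCLM.contDiff.comp contDiff_f

theorem f_of_le {x : ℝ} (hx : 3 * Real.pi / 4 ≤ x) :
    f x = Real.exp (3 * Real.pi / 4) / √2 * Real.exp (-x) := by
  have := Real.pi_pos
  rw [f, if_pos (by linarith), theta, if_neg hx.not_gt]

theorem f_neg (x : ℝ) : f (-x) = -f x := by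
  rcases lt_trichotomy x 0 with h | rfl | h
  · simp [f, h.le, h.not_ge]
  · simp [f, theta_zero]
  · simp [f, h.le, h.not_ge]

theorem f_of_abs_le {x : ℝ} (hx : |x| ≤ 3 * Real.pi / 4) : f x = Real.sin x := by
  have key : ∀ y : ℝ, 0 ≤ y → y ≤ 3 * Real.pi / 4 → f y = Real.sin y := by
    intro y h0 hy
    rcases hy.lt_or_eq with hy | rfl
    · rw [f, if_pos h0, theta, if_pos hy]
    · rw [f_of_le le_rfl, theta_coeff_mul_exp, sin_three_pi_div_four]
  rcases le_total 0 x with h | h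
  · exact key x h (by rwa [abs_of_nonneg h] at hx)
  · have := key (-x) (by linarith) (by rwa [abs_of_nonpos h] at hx)
    rw [f_neg, Real.sin_neg] at this
    linarith

theorem abs_f_le (x : ℝ) : |f x| ≤ Real.exp (3 * Real.pi / 4) * Real.exp (-|x|) := by
  have key : ∀ y : ℝ, 0 ≤ y → |f y| ≤ Real.exp (3 * Real.pi / 4) * Real.exp (-|y|) := by
    intro y h0
    rw [abs_of_nonneg h0]
    rcases le_total y (3 * Real.pi / 4) with hy | hy
    · rw [f_of_abs_le (by rwa [abs_of_nonneg h0]), ← Real.exp_add]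
      exact (Real.abs_sin_le_one y).trans (Real.one_le_exp (by linarith))
    · rw [f_of_le hy, abs_of_nonneg (by positivity)]
      gcongr
      exact div_le_self (Real.exp_pos _).le (Real.one_le_sqrt.2 (by norm_num))
  rcases le_total 0 x with h | h
  · exact key x h
  · simpa [f_neg] using key (-x) (by linarith)

theorem integrable_exp_mul_abs {a : ℝ} (ha : a < 0) : Integrable fun x : ℝ => Real.exp (a * |x|) := by
  rw [← integrableOn_univ, ← Iic_union_Ioi (a := (0 : ℝ))]
  refine IntegrableOn.union ?_ ?_
  · refine (integrableOn_exp_mul_Iic (neg_pos.2 ha) 0).congr_fun (fun x hx => ?_) measurableSet_Iic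
    simp only [abs_of_nonpos (mem_Iic.1 hx), mul_neg, neg_mul]
  · refine (integrableOn_exp_mul_Ioi ha 0).congr_fun (fun x hx => ?_) measurableSet_Ioi
    simp only [abs_of_pos (mem_Ioi.1 hx)]

theorem memLp_fC : MemLp fC 2 (volume : Measure ℝ) := by
  rw [memLp_two_iff_integrable_sq_norm contDiff_fC.continuous.aestronglyMeasurable]
  have hint : Integrable (fun x : ℝ => Real.exp (3 * Real.pi / 4) ^ 2 * Real.exp (-2 * |x|)) :=
    (integrable_exp_mul_abs (by norm_num)).const_mul _
  refine hint.mono' (contDiff_fC.continuous.norm.pow 2).aestronglyMeasurable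
    (Eventually.of_forall fun x => ?_)
  have hx := abs_f_le x
  have e : Real.exp (-2 * |x|) = Real.exp (-|x|) ^ 2 := by
    rw [← Real.exp_nat_mul]; congr 1; push_cast; ring
  rw [Real.norm_eq_abs, abs_of_nonneg (by positivity), e, ← mul_pow]
  simp only [fC, Complex.norm_real, Real.norm_eq_abs]
  gcongr

/-- The concomitant `p φ''' - p' φ'' + p'' φ' - p''' φ`. -/
def concomitant (p p₁ p₂ p₃ φ : ℝ → ℂ) (x : ℝ) : ℂ :=
  p x * iteratedDeriv 3 φ x - p₁ x * iteratedDeriv 2 φ x + p₂ x * iteratedDeriv 1 φ x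
    - p₃ x * φ x

theorem hasDerivAt_iteratedDeriv {φ : ℝ → ℂ} (hφ : ContDiff ℝ ∞ φ) (n : ℕ) (x : ℝ) :
    HasDerivAt (iteratedDeriv n φ) (iteratedDeriv (n + 1) φ x) x := by
  rw [iteratedDeriv_succ]
  exact ((hφ.differentiable_iteratedDeriv n
    (WithTop.coe_lt_coe.2 (ENat.natCast_lt_top n))) x).hasDerivAt

theorem hasCompactSupport_iteratedDeriv {φ : ℝ → ℂ} (hc : HasCompactSupport φ) (n : ℕ) :
    HasCompactSupport (iteratedDeriv n φ) := by
  induction n with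
  | zero => simpa
  | succ n ih => rw [iteratedDeriv_succ]; exact ih.deriv

theorem continuous_iteratedDeriv {φ : ℝ → ℂ} (hφ : ContDiff ℝ ∞ φ) (n : ℕ) :
    Continuous (iteratedDeriv n φ) :=
  hφ.continuous_iteratedDeriv n (WithTop.coe_le_coe.2 le_top)

section Concomitant

variable {p p₁ p₂ p₃ φ : ℝ → ℂ}

theorem hasDerivAt_concomitant (h : ∀ x, HasDerivAt p (p₁ x) x)
    (h₁ : ∀ x, HasDerivAt p₁ (p₂ x) x) (h₂ : ∀ x, HasDerivAt p₂ (p₃ x) x)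
    (h₃ : ∀ x, HasDerivAt p₃ (p x) x) (hφ : ContDiff ℝ ∞ φ) (x : ℝ) :
    HasDerivAt (concomitant p p₁ p₂ p₃ φ) (p x * iteratedDeriv 4 φ x - p x * φ x) x := by
  have d0 : HasDerivAt φ (iteratedDeriv 1 φ x) x := by
    simpa using hasDerivAt_iteratedDeriv hφ 0 x
  have := ((((h x).mul (hasDerivAt_iteratedDeriv hφ 3 x)).sub
    ((h₁ x).mul (hasDerivAt_iteratedDeriv hφ 2 x))).add
    ((h₂ x).mul (hasDerivAt_iteratedDeriv hφ 1 x))).sub ((h₃ x).mul d0)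
  refine this.congr_deriv ?_
  ring

theorem hasCompactSupport_concomitant (hc : HasCompactSupport φ) :
    HasCompactSupport (concomitant p p₁ p₂ p₃ φ) :=
  ((((hasCompactSupport_iteratedDeriv hc 3).mul_left (f := p)).sub
    ((hasCompactSupport_iteratedDeriv hc 2).mul_left (f := p₁))).add
    ((hasCompactSupport_iteratedDeriv hc 1).mul_left (f := p₂))).sub (hc.mul_left (f := p₃))

end Concomitant

theorem integral_eq_Iic_add_interval_add_Ioi {F : ℝ → ℂ} (hF : Integrable F) (a b : ℝ) :
    ∫ x, F x = (∫ x in Iic a, F x) + (∫ x in a..b, F x) + ∫ x in Ioi b, F x := by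
  rw [← intervalIntegral.integral_Iic_sub_Iic hF.integrableOn hF.integrableOn,
    ← intervalIntegral.integral_Iic_add_Ioi hF.integrableOn hF.integrableOn (b := b)]
  ring

theorem hasDerivAt_fC_right :
    HasDerivAt fC (-((√2 / 2 : ℝ) : ℂ)) (3 * Real.pi / 4) := by
  have hd : DifferentiableAt ℝ f (3 * Real.pi / 4) := contDiff_f.differentiable (by norm_num) _
  have h1 : HasDerivWithinAt f (Real.cos (3 * Real.pi / 4)) (Icc 0 (3 * Real.pi / 4))
      (3 * Real.pi / 4) := by
    have := Real.pi_pos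
    refine (Real.hasDerivAt_sin _).hasDerivWithinAt.congr (fun y hy => ?_) ?_
    · exact f_of_abs_le (by rw [abs_of_nonneg hy.1]; exact hy.2)
    · exact f_of_abs_le (by rw [abs_of_nonneg (by positivity)])
  have := UniqueDiffWithinAt.eq_deriv _
    ((uniqueDiffOn_Icc (by positivity)) _ (right_mem_Icc.2 (by positivity)))
    hd.hasDerivAt.hasDerivWithinAt h1
  have h2 := hd.hasDerivAt
  rw [this, cos_three_pi_div_four] at h2
  rw [← Complex.ofReal_neg]
  exact h2.ofReal_comp

theorem hasDerivAt_fC_left :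
    HasDerivAt fC (-((√2 / 2 : ℝ) : ℂ)) (-(3 * Real.pi / 4)) := by
  have : fC = fun x => -fC (-x) := by
    funext x; simp [fC, f_neg]
  rw [this]
  have h := hasDerivAt_fC_right
  rw [← neg_neg (3 * Real.pi / 4)] at h
  have := (h.scomp (-(3 * Real.pi / 4)) (hasDerivAt_neg (-(3 * Real.pi / 4)))).fun_neg
  simpa [Function.comp_def] using this

theorem fC_right : fC (3 * Real.pi / 4) = ((√2 / 2 : ℝ) : ℂ) := by
  rw [fC, f_of_le le_rfl, theta_coeff_mul_exp]

theorem fC_left : fC (-(3 * Real.pi / 4)) = -((√2 / 2 : ℝ) : ℂ) := by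
  rw [← fC_right, fC, f_neg, fC, Complex.ofReal_neg]

theorem formalL_fC : DistEq (formalL fC) (ofFun fC) := by
  intro φ hφ hc
  have hpi := Real.pi_pos
  set b : ℝ := 3 * Real.pi / 4 with hb
  set s : ℂ := ((√2 / 2 : ℝ) : ℂ) with hs
  have hb0 : 0 < b := by positivity
  have hφd : ∀ x, HasDerivAt φ (iteratedDeriv 1 φ x) x := fun x => by
    simpa using hasDerivAt_iteratedDeriv hφ 0 x
  have hfl : LocallyIntegrable fC := contDiff_fC.continuous.locallyIntegrable
  have i4 := integrable_mul_test hfl (continuous_fourth hφ) (hasCompactSupport_fourth hc)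
  have i0 := integrable_mul_test hfl hφ.continuous hc
  set F : ℝ → ℂ := fun x => fC x * iteratedDeriv 4 φ x - fC x * φ x with hF
  have hFi : Integrable F := i4.sub i0
  -- the three smooth pieces
  set c : ℝ := Real.exp b / √2 with hcdef
  have hcb : c * Real.exp (-b) = √2 / 2 := theta_coeff_mul_exp
  have e1 : ∀ k : ℝ, ∀ x : ℝ, HasDerivAt (fun x : ℝ => ((k * Real.exp (-x) : ℝ) : ℂ))
      (((-k) * Real.exp (-x) : ℝ) : ℂ) x := fun k x => by
    refine HasDerivAt.ofReal_comp ?_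
    have := (((hasDerivAt_neg x).exp).const_mul k)
    refine this.congr_deriv ?_
    ring
  have e2 : ∀ k : ℝ, ∀ x : ℝ, HasDerivAt (fun x : ℝ => ((k * Real.exp x : ℝ) : ℂ))
      ((k * Real.exp x : ℝ) : ℂ) x := fun k x =>
    HasDerivAt.ofReal_comp ((Real.hasDerivAt_exp x).const_mul k)
  have e3 : ∀ k : ℝ, ∀ x : ℝ, HasDerivAt (fun x : ℝ => ((k * Real.sin x : ℝ) : ℂ))
      ((k * Real.cos x : ℝ) : ℂ) x := fun k x =>
    HasDerivAt.ofReal_comp ((Real.hasDerivAt_sin x).const_mul k)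
  have e4 : ∀ k : ℝ, ∀ x : ℝ, HasDerivAt (fun x : ℝ => ((k * Real.cos x : ℝ) : ℂ))
      (((-k) * Real.sin x : ℝ) : ℂ) x := fun k x => by
    refine HasDerivAt.ofReal_comp (((Real.hasDerivAt_cos x).const_mul k).congr_deriv ?_)
    ring
  have w1 := hasDerivAt_concomitant (e1 c) (e1 (-c)) (e1 (- -c))
    (by simpa using e1 (- - -c)) hφ
  have w2 := hasDerivAt_concomitant (e2 (-c)) (e2 (-c)) (e2 (-c)) (e2 (-c)) hφ
  have w3 := hasDerivAt_concomitant (e3 1) (e4 1) (e3 (-1)) (by simpa using e4 (-1)) hφ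
  have c1 : Continuous (fun x => ((c * Real.exp (-x) : ℝ) : ℂ) * iteratedDeriv 4 φ x
      - ((c * Real.exp (-x) : ℝ) : ℂ) * φ x) := by
    have := continuous_fourth hφ; have := hφ.continuous; fun_prop
  have c2 : Continuous (fun x => (((-c) * Real.exp x : ℝ) : ℂ) * iteratedDeriv 4 φ x
      - (((-c) * Real.exp x : ℝ) : ℂ) * φ x) := by
    have := continuous_fourth hφ; have := hφ.continuous; fun_prop
  have c3 : Continuous (fun x => ((1 * Real.sin x : ℝ) : ℂ) * iteratedDeriv 4 φ x
      - ((1 * Real.sin x : ℝ) : ℂ) * φ x) := by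
    have := continuous_fourth hφ; have := hφ.continuous; fun_prop
  have I1 : ∫ x in Ioi b, F x = -(s * iteratedDeriv 3 φ b + s * iteratedDeriv 2 φ b
      + s * iteratedDeriv 1 φ b + s * φ b) := by
    have hW := HasCompactSupport.integral_Ioi_deriv_eq
      (contDiff_one_iff_deriv.2 ⟨fun x => (w1 x).differentiableAt,
        by rw [funext fun x => (w1 x).deriv]; exact c1⟩) (hasCompactSupport_concomitant hc) b
    rw [funext fun x => (w1 x).deriv] at hW
    rw [setIntegral_congr_fun measurableSet_Ioi
      (g := fun x => ((c * Real.exp (-x) : ℝ) : ℂ) * iteratedDeriv 4 φ x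
      - ((c * Real.exp (-x) : ℝ) : ℂ) * φ x), hW]
    · simp only [concomitant, neg_neg, neg_mul, hcb, Complex.ofReal_neg, ← hs]
      ring
    · intro x hx
      simp only [hF, fC, f_of_le (le_of_lt hx)]
      rfl
  have I2 : ∫ x in Iic (-b), F x = -s * iteratedDeriv 3 φ (-b) + s * iteratedDeriv 2 φ (-b)
      - s * iteratedDeriv 1 φ (-b) + s * φ (-b) := by
    have hW := HasCompactSupport.integral_Iic_deriv_eq
      (contDiff_one_iff_deriv.2 ⟨fun x => (w2 x).differentiableAt,
        by rw [funext fun x => (w2 x).deriv]; exact c2⟩) (hasCompactSupport_concomitant hc) (-b)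
    rw [funext fun x => (w2 x).deriv] at hW
    rw [setIntegral_congr_fun measurableSet_Iic
      (g := fun x => (((-c) * Real.exp x : ℝ) : ℂ) * iteratedDeriv 4 φ x
      - (((-c) * Real.exp x : ℝ) : ℂ) * φ x), hW]
    · simp only [concomitant, neg_mul, hcb, Complex.ofReal_neg, ← hs]
      ring
    · intro x hx
      have : f x = -c * Real.exp x := by
        have := f_of_le (x := -x) (by simpa using neg_le_neg (mem_Iic.1 hx))
        rw [f_neg, neg_neg] at this
        linarith
      simp only [hF, fC, this]
  have I3 : ∫ x in (-b)..b, F x = s * iteratedDeriv 3 φ b + s * iteratedDeriv 2 φ b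
      - s * iteratedDeriv 1 φ b - s * φ b - (-s * iteratedDeriv 3 φ (-b)
      + s * iteratedDeriv 2 φ (-b) + s * iteratedDeriv 1 φ (-b) - s * φ (-b)) := by
    have hW := intervalIntegral.integral_eq_sub_of_hasDerivAt (a := -b) (b := b)
      (fun x _ => w3 x) (c3.intervalIntegrable _ _)
    rw [intervalIntegral.integral_congr (g := fun x => ((1 * Real.sin x : ℝ) : ℂ)
      * iteratedDeriv 4 φ x - ((1 * Real.sin x : ℝ) : ℂ) * φ x), hW]
    · have hsin : Real.sin b = √2 / 2 := sin_three_pi_div_four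
      have hcos : Real.cos b = -(√2 / 2) := cos_three_pi_div_four
      simp only [concomitant, neg_mul, one_mul, Real.sin_neg, Real.cos_neg, hsin, hcos, neg_neg,
        Complex.ofReal_neg, ← hs]
      ring
    · intro x hx
      rw [uIcc_of_le (by linarith)] at hx
      simp only [hF, fC, f_of_abs_le (abs_le.2 hx), one_mul]
  have hsum := integral_eq_Iic_add_interval_add_Ioi hFi (-b) b
  rw [I1, I2, I3, hF, integral_sub i4 i0] at hsum
  have d1 : deriv (fun x => fC x * φ x) b = -s * φ b + s * iteratedDeriv 1 φ b := by
    rw [(hasDerivAt_fC_right.fun_mul (hφd b)).deriv, fC_right]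
  have d2 : deriv (fun x => fC x * φ x) (-b) = -s * φ (-b) + (-s) * iteratedDeriv 1 φ (-b) := by
    rw [(hasDerivAt_fC_left.fun_mul (hφd (-b))).deriv, fC_left]
  simp only [formalL, Pi.add_apply, mulFun, qs_apply, diracDeriv, dirac, fourthDeriv, ofFun]
  rw [← hb, d1, d2, fC_right, fC_left, ← hs]
  linear_combination hsum

theorem isEigenvector_fC : IsEigenvector L 1 (memLp_fC.toLp fC) := by
  refine ⟨fun h0 => ?_, ?_⟩
  · have h1 : fC =ᵐ[volume] fun _ => 0 :=
      memLp_fC.coeFn_toLp.symm.trans ((Lp.eq_zero_iff_ae_eq_zero).1 h0)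
    have h2 := congrFun ((Continuous.ae_eq_iff_eq volume contDiff_fC.continuous
      continuous_const).1 h1) (3 * Real.pi / 4)
    rw [fC_right] at h2
    have : √2 / 2 = 0 := by exact_mod_cast h2
    simp at this
  · have hmem : (memLp_fC.toLp fC, memLp_fC.toLp fC) ∈ L.graph := by
      refine (mem_graph_L _).2 ⟨fC, contDiff_fC, memLp_fC.coeFn_toLp, fun φ hφ hc => ?_⟩
      rw [formalL_fC φ hφ hc]
      refine integral_congr_ae ?_
      filter_upwards [memLp_fC.coeFn_toLp] with x hx
      rw [hx]
    obtain ⟨y, hy, hy'⟩ := (LinearPMap.mem_graph_iff L).1 hmem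
    have hy : (y : L2) = memLp_fC.toLp fC := hy
    refine ⟨hy ▸ y.2, ?_⟩
    rw [one_smul]
    refine Eq.trans ?_ hy'
    congr 1
    exact Subtype.ext hy.symm

/-- The integral pairing with a fixed square-integrable function, as a functional on `L²(ℝ)`. -/
theorem exists_clm_eq_integral_mul {k : ℝ → ℂ} (hk : MemLp k 2 (volume : Measure ℝ)) :
    ∃ ℓ : L2 →L[ℂ] ℂ, ∀ g : L2, ℓ g = ∫ x, k x * g x := by
  refine ⟨innerSL ℂ (hk.star.toLp _), fun g => ?_⟩
  rw [innerSL_apply_apply, L2.inner_def]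
  refine integral_congr_ae ?_
  filter_upwards [hk.star.coeFn_toLp] with x hx
  rw [hx]
  simp [mul_comm]

/-- The operator `L - z` on the domain of `L`. -/
def LSub (z : ℂ) : L.domain →ₗ[ℂ] L2 := L.toFun - z • L.domain.subtype

theorem mem_range_LSub {z : ℂ} {u g : L2} {v : ℝ → ℂ} (hv : ContDiff ℝ 1 v)
    (hu : (u : ℝ → ℂ) =ᵐ[volume] v)
    (h : ∀ φ : ℝ → ℂ, ContDiff ℝ ∞ φ → HasCompactSupport φ →
      formalL v φ = z * (∫ x, v x * φ x) + ∫ x, g x * φ x) : g ∈ (LSub z).range := by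
  have hmem : (u, z • u + g) ∈ L.graph := by
    refine (mem_graph_L _).2 ⟨v, hv, hu, fun φ hφ hc => ?_⟩
    rw [h φ hφ hc, ← integral_const_mul, ofFun, ← integral_add
      ((integrable_mul_test hv.continuous.locallyIntegrable hφ.continuous hc).const_mul z)
      (integrable_mul_test (L2.locallyIntegrable g) hφ.continuous hc)]
    refine integral_congr_ae ?_
    filter_upwards [hu, Lp.coeFn_add (z • u) g, Lp.coeFn_smul z u] with x h1 h2 h3
    rw [h2, Pi.add_apply, h3, Pi.smul_apply, h1, smul_eq_mul]
    ring
  obtain ⟨y, hy, hy'⟩ := (LinearPMap.mem_graph_iff L).1 hmem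
  refine ⟨y, ?_⟩
  change L y - z • (y : L2) = g
  rw [show L y = z • u + g from hy', show (y : L2) = u from hy, add_sub_cancel_left]

theorem integral_fourier_mul_test (h : L2) {φ : ℝ → ℂ} (hφ : ContDiff ℝ ∞ φ)
    (hc : HasCompactSupport φ) : ∫ x, (𝓕 h : L2) x * φ x = ∫ x, h x * 𝓕 φ x := by
  have := DFunLike.congr_fun (Lp.fourier_toTemperedDistribution_eq h) (hc.toSchwartzMap hφ)
  rw [TemperedDistribution.fourier_apply, Lp.toTemperedDistribution_apply,
    Lp.toTemperedDistribution_apply] at this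
  have hcoe : (hc.toSchwartzMap hφ : ℝ → ℂ) = φ := rfl
  simpa [SchwartzMap.fourier_coe, hcoe, mul_comm] using this.symm

theorem integral_fourier_mul_eq {F φ : ℝ → ℂ} (hF : Integrable F) (hφ : Integrable φ) :
    ∫ x, 𝓕 F x * φ x = ∫ x, F x * 𝓕 φ x := by
  have := VectorFourier.integral_fourierIntegral_smul_eq_flip (L := innerₗ ℝ)
    Real.continuous_fourierChar continuous_inner hF hφ
  rwa [flip_innerₗ] at this

theorem fourier_fourth {φ : ℝ → ℂ} (hφ : ContDiff ℝ ∞ φ) (hc : HasCompactSupport φ) (x : ℝ) :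
    𝓕 (iteratedDeriv 4 φ) x = ((2 * Real.pi * x : ℝ) : ℂ) ^ 4 * 𝓕 φ x := by
  have := congrFun (Real.fourier_iteratedDeriv (N := ⊤) (n := 4) hφ (fun n _ =>
    (continuous_iteratedDeriv hφ n).integrable_of_hasCompactSupport
      (hasCompactSupport_iteratedDeriv hc n)) le_top) x
  rw [this, smul_eq_mul]
  congr 1
  push_cast
  linear_combination (2 * Real.pi * x : ℂ) ^ 4 * Complex.I_pow_four

/-- The symbol of `(d⁴/dx⁴ - z)⁻¹`. -/
def symbol (z : ℂ) (ξ : ℝ) : ℂ := (((2 * Real.pi * ξ : ℝ) : ℂ) ^ 4 - z)⁻¹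

section Symbol

variable {z : ℂ}

theorem symbol_den_ne_zero (hz : ∀ r : ℝ, 0 ≤ r → (r : ℂ) ≠ z) (ξ : ℝ) :
    ((2 * Real.pi * ξ : ℝ) : ℂ) ^ 4 - z ≠ 0 := by
  rw [← Complex.ofReal_pow]
  exact sub_ne_zero.2 (hz _ (by positivity))

theorem continuous_symbol (hz : ∀ r : ℝ, 0 ≤ r → (r : ℂ) ≠ z) : Continuous (symbol z) :=
  Continuous.inv₀ (by fun_prop) (symbol_den_ne_zero hz)

theorem exists_norm_symbol_le (hz : ∀ r : ℝ, 0 ≤ r → (r : ℂ) ≠ z) :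
    ∃ C : ℝ, ∀ ξ : ℝ, ‖symbol z ξ‖ ≤ C * (1 + ξ ^ 2)⁻¹ := by
  have hcl : IsClosed ((fun r : ℝ => (r : ℂ)) '' Ici 0) :=
    Complex.isometry_ofReal.isClosedEmbedding.isClosedMap _ isClosed_Ici
  have hzn : z ∉ (fun r : ℝ => (r : ℂ)) '' Ici 0 := by
    rintro ⟨r, hr, h⟩
    exact hz r hr h
  obtain ⟨d, hd, hball⟩ := Metric.isOpen_iff.1 hcl.isOpen_compl z hzn
  have hdist : ∀ r : ℝ, 0 ≤ r → d ≤ ‖(r : ℂ) - z‖ := by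
    intro r hr
    by_contra! hlt
    exact hball (mem_ball_iff_norm.2 hlt) ⟨r, hr, rfl⟩
  refine ⟨1 + (2 + ‖z‖) / d, fun ξ => ?_⟩
  set t : ℝ := (2 * Real.pi * ξ) ^ 4 with ht
  have ht0 : 0 ≤ t := by positivity
  have hD := hdist t ht0
  have hD0 : 0 < ‖(t : ℂ) - z‖ := hd.trans_le hD
  have h1 : t ≤ ‖(t : ℂ) - z‖ + ‖z‖ := by
    have := norm_sub_norm_le (t : ℂ) z
    rw [Complex.norm_real, Real.norm_of_nonneg ht0] at this
    linarith
  have h2 : 1 + ξ ^ 2 ≤ 2 + t := by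
    have hpi := Real.pi_gt_three
    have h3 : ξ ^ 2 ≤ (2 * Real.pi * ξ) ^ 2 := by
      rw [mul_pow]
      exact le_mul_of_one_le_left (sq_nonneg _) (by nlinarith)
    have : t = ((2 * Real.pi * ξ) ^ 2) ^ 2 := by rw [ht]; ring
    nlinarith [sq_nonneg ((2 * Real.pi * ξ) ^ 2 - 1)]
  have h4 : 2 + ‖z‖ ≤ (2 + ‖z‖) / d * ‖(t : ℂ) - z‖ := by
    rw [div_mul_eq_mul_div, le_div_iff₀ hd]
    exact mul_le_mul_of_nonneg_left hD (by positivity)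
  have h5 : 1 + ξ ^ 2 ≤ (1 + (2 + ‖z‖) / d) * ‖(t : ℂ) - z‖ := by
    rw [add_mul, one_mul]; linarith
  rw [symbol, ← Complex.ofReal_pow, ← ht, norm_inv, ← div_eq_mul_inv, inv_eq_one_div,
    div_le_div_iff₀ hD0 (by positivity), one_mul]
  exact h5

theorem memLp_inv_one_add_sq : MemLp (fun ξ : ℝ => (1 + ξ ^ 2)⁻¹) 2 (volume : Measure ℝ) := by
  have hc : Continuous fun ξ : ℝ => (1 + ξ ^ 2)⁻¹ :=
    Continuous.inv₀ (by fun_prop) fun ξ => by positivity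
  rw [memLp_two_iff_integrable_sq_norm hc.aestronglyMeasurable]
  refine integrable_inv_one_add_sq.mono' (hc.norm.pow 2).aestronglyMeasurable
    (Eventually.of_forall fun ξ => ?_)
  have h1 : (1 + ξ ^ 2)⁻¹ ≤ 1 := inv_le_one_of_one_le₀ (by nlinarith [sq_nonneg ξ])
  have h0 : 0 ≤ (1 + ξ ^ 2)⁻¹ := by positivity
  rw [norm_pow, norm_norm, Real.norm_of_nonneg h0]
  nlinarith

theorem memLp_mul_inv_one_add_sq :
    MemLp (fun ξ : ℝ => ξ * (1 + ξ ^ 2)⁻¹) 2 (volume : Measure ℝ) := by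
  have hc : Continuous fun ξ : ℝ => ξ * (1 + ξ ^ 2)⁻¹ :=
    continuous_id.mul (Continuous.inv₀ (by fun_prop) fun ξ => by positivity)
  rw [memLp_two_iff_integrable_sq_norm hc.aestronglyMeasurable]
  refine integrable_inv_one_add_sq.mono' (hc.norm.pow 2).aestronglyMeasurable
    (Eventually.of_forall fun ξ => ?_)
  have h0 : 0 < 1 + ξ ^ 2 := by positivity
  rw [norm_pow, norm_norm, Real.norm_eq_abs, sq_abs, mul_pow, inv_pow, ← div_eq_mul_inv,
    inv_eq_one_div, div_le_div_iff₀ (by positivity) h0]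
  nlinarith [sq_nonneg ξ]

theorem memLp_symbol (hz : ∀ r : ℝ, 0 ≤ r → (r : ℂ) ≠ z) :
    MemLp (symbol z) 2 (volume : Measure ℝ) := by
  obtain ⟨C, hC⟩ := exists_norm_symbol_le hz
  exact (memLp_inv_one_add_sq.const_mul C).mono' (continuous_symbol hz).aestronglyMeasurable
    (Eventually.of_forall hC)

theorem memLp_mul_symbol (hz : ∀ r : ℝ, 0 ≤ r → (r : ℂ) ≠ z) :
    MemLp (fun ξ : ℝ => (ξ : ℂ) * symbol z ξ) 2 (volume : Measure ℝ) := by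
  obtain ⟨C, hC⟩ := exists_norm_symbol_le hz
  refine (memLp_mul_inv_one_add_sq.norm.const_mul C).mono'
    (Complex.continuous_ofReal.mul (continuous_symbol hz)).aestronglyMeasurable
    (Eventually.of_forall fun ξ => ?_)
  have h0 : 0 ≤ (1 + ξ ^ 2)⁻¹ := by positivity
  rw [norm_mul, Complex.norm_real, norm_mul, Real.norm_of_nonneg h0, mul_left_comm]
  exact mul_le_mul_of_nonneg_left (hC ξ) (norm_nonneg _)

theorem memLp_symbol_mul (hz : ∀ r : ℝ, 0 ≤ r → (r : ℂ) ≠ z) (h : L2) :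
    MemLp (fun ξ => symbol z ξ * h ξ) 2 (volume : Measure ℝ) := by
  obtain ⟨C, hC⟩ := exists_norm_symbol_le hz
  refine (Lp.memLp h).of_le_mul (c := |C|)
    ((continuous_symbol hz).aestronglyMeasurable.mul (Lp.aestronglyMeasurable h))
    (Eventually.of_forall fun ξ => ?_)
  rw [norm_mul]
  refine mul_le_mul_of_nonneg_right ((hC ξ).trans ?_) (norm_nonneg _)
  have h0 : 0 ≤ (1 + ξ ^ 2)⁻¹ := by positivity
  have h1 : (1 + ξ ^ 2)⁻¹ ≤ 1 := inv_le_one_of_one_le₀ (by nlinarith [sq_nonneg ξ])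
  calc C * (1 + ξ ^ 2)⁻¹ ≤ |C| * (1 + ξ ^ 2)⁻¹ := by gcongr; exact le_abs_self C
    _ ≤ |C| * 1 := by gcongr
    _ = |C| := mul_one _

theorem integrable_symbol_mul (hz : ∀ r : ℝ, 0 ≤ r → (r : ℂ) ≠ z) (h : L2) :
    Integrable (fun ξ => symbol z ξ * h ξ) :=
  (memLp_symbol hz).integrable_mul (Lp.memLp h)

theorem integrable_mul_symbol_mul (hz : ∀ r : ℝ, 0 ≤ r → (r : ℂ) ≠ z) (h : L2) :
    Integrable (fun ξ : ℝ => (ξ : ℂ) * (symbol z ξ * h ξ)) := by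
  simpa only [Pi.mul_def, mul_assoc] using (memLp_mul_symbol hz).integrable_mul (Lp.memLp h)

/-- The free resolvent `(d⁴/dx⁴ - z)⁻¹` applied to the Fourier transform of `h`. -/
def resolventFun (z : ℂ) (h : L2) : ℝ → ℂ := 𝓕 fun ξ => symbol z ξ * h ξ

theorem contDiff_resolventFun (hz : ∀ r : ℝ, 0 ≤ r → (r : ℂ) ≠ z) (h : L2) :
    ContDiff ℝ 1 (resolventFun z h) := by
  refine Real.contDiff_fourier (N := 1) fun n hn => ?_
  have hn : n ≤ 1 := by exact_mod_cast hn
  interval_cases n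
  · simpa using (integrable_symbol_mul hz h).norm
  · simpa only [pow_one, norm_mul, Complex.norm_real] using (integrable_mul_symbol_mul hz h).norm

theorem exists_clm_eq_resolventFun (hz : ∀ r : ℝ, 0 ≤ r → (r : ℂ) ≠ z) (x : ℝ) :
    ∃ ℓ : L2 →L[ℂ] ℂ, ∀ h, ℓ h = resolventFun z h x := by
  have hk : MemLp (fun ξ : ℝ => Complex.exp ((-2 * Real.pi * ξ * x : ℝ) * Complex.I) * symbol z ξ)
      2 (volume : Measure ℝ) :=
    (memLp_symbol hz).of_le
      ((Continuous.mul (by fun_prop) (continuous_symbol hz)).aestronglyMeasurable)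
      (Eventually.of_forall fun ξ => by rw [norm_mul, Complex.norm_exp_ofReal_mul_I, one_mul])
  obtain ⟨ℓ, hℓ⟩ := exists_clm_eq_integral_mul hk
  refine ⟨ℓ, fun h => ?_⟩
  rw [hℓ, resolventFun, Real.fourier_real_eq_integral_exp_smul]
  simp only [smul_eq_mul, mul_assoc]

theorem exists_clm_eq_deriv_resolventFun (hz : ∀ r : ℝ, 0 ≤ r → (r : ℂ) ≠ z) (x : ℝ) :
    ∃ ℓ : L2 →L[ℂ] ℂ, ∀ h, ℓ h = deriv (resolventFun z h) x := by
  have hk : MemLp (fun ξ : ℝ => Complex.exp ((-2 * Real.pi * ξ * x : ℝ) * Complex.I)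
      * (-2 * Real.pi * Complex.I * (ξ * symbol z ξ))) 2 (volume : Measure ℝ) := by
    refine ((memLp_mul_symbol hz).const_mul (-2 * Real.pi * Complex.I)).of_le
      ((Continuous.mul (by fun_prop) (continuous_const.mul
        (Complex.continuous_ofReal.mul (continuous_symbol hz)))).aestronglyMeasurable)
      (Eventually.of_forall fun ξ => ?_)
    rw [norm_mul, Complex.norm_exp_ofReal_mul_I, one_mul]
  obtain ⟨ℓ, hℓ⟩ := exists_clm_eq_integral_mul hk
  refine ⟨ℓ, fun h => ?_⟩
  rw [hℓ, resolventFun, Real.deriv_fourier (integrable_symbol_mul hz h)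
    (by simpa using integrable_mul_symbol_mul hz h), Real.fourier_real_eq_integral_exp_smul]
  simp only [smul_eq_mul, mul_assoc]

theorem fourier_ae_eq_resolventFun (hz : ∀ r : ℝ, 0 ≤ r → (r : ℂ) ≠ z) (h : L2) :
    ((𝓕 ((memLp_symbol_mul hz h).toLp _) : L2) : ℝ → ℂ) =ᵐ[volume] resolventFun z h := by
  refine ae_eq_of_integral_contDiff_smul_eq (L2.locallyIntegrable _)
    (contDiff_resolventFun hz h).continuous.locallyIntegrable fun g hg hgc => ?_
  have hφ : ContDiff ℝ ∞ (fun x => (g x : ℂ)) := Complex.ofRealCLM.contDiff.comp hg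
  have hφc : HasCompactSupport (fun x => (g x : ℂ)) :=
    hgc.comp_left (g := fun r : ℝ => (r : ℂ)) Complex.ofReal_zero
  have h1 := integral_fourier_mul_test ((memLp_symbol_mul hz h).toLp _) hφ hφc
  have h2 := integral_fourier_mul_eq (integrable_symbol_mul hz h)
    (hφ.continuous.integrable_of_hasCompactSupport hφc)
  simp only [Complex.real_smul, mul_comm (Complex.ofReal _)]
  rw [h1, resolventFun, h2]
  refine integral_congr_ae ?_
  filter_upwards [(memLp_symbol_mul hz h).coeFn_toLp] with x hx
  rw [hx]

theorem fourthDeriv_resolventFun (hz : ∀ r : ℝ, 0 ≤ r → (r : ℂ) ≠ z) (h : L2) {φ : ℝ → ℂ}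
    (hφ : ContDiff ℝ ∞ φ) (hc : HasCompactSupport φ) :
    fourthDeriv (resolventFun z h) φ
      = z * (∫ x, resolventFun z h x * φ x) + ∫ x, (𝓕 h : L2) x * φ x := by
  have hF := integrable_symbol_mul hz h
  have i0 := hφ.continuous.integrable_of_hasCompactSupport hc (μ := volume)
  have i4 := (continuous_fourth hφ).integrable_of_hasCompactSupport
    (hasCompactSupport_fourth hc) (μ := volume)
  obtain ⟨C, hC⟩ : ∃ C, ∀ x, ‖𝓕 φ x‖ ≤ C :=
    ⟨_, fun x => VectorFourier.norm_fourierIntegral_le_integral_norm _ _ _ _ x⟩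
  have hcont : Continuous (𝓕 φ) :=
    VectorFourier.fourierIntegral_continuous Real.continuous_fourierChar continuous_inner i0
  have j0 : Integrable fun ξ => symbol z ξ * h ξ * 𝓕 φ ξ :=
    hF.mul_bdd hcont.aestronglyMeasurable (Eventually.of_forall hC)
  have j1 : Integrable fun ξ => h ξ * 𝓕 φ ξ :=
    (Lp.memLp h).integrable_mul (q := 2) (by
      have := ((hc.toSchwartzMap hφ).fourierTransformCLM ℂ).memLp 2 (volume : Measure ℝ)
      exact this)
  rw [fourthDeriv, resolventFun, integral_fourier_mul_eq hF i4, integral_fourier_mul_eq hF i0,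
    integral_fourier_mul_test h hφ hc, ← integral_const_mul, ← integral_add (j0.const_mul z) j1]
  congr 1
  funext ξ
  rw [fourier_fourth hφ hc, symbol]
  have := symbol_den_ne_zero hz ξ
  field_simp
  ring

/-- Outside of `[0, ∞)` the range of `L - z` is closed. -/
theorem isClosed_range_LSub (hz : ∀ r : ℝ, 0 ≤ r → (r : ℂ) ≠ z) :
    IsClosed ((LSub z).range : Set L2) := by
  choose ℓ hℓ using exists_clm_eq_resolventFun hz
  choose ℓ' hℓ' using exists_clm_eq_deriv_resolventFun hz
  set b : ℝ := 3 * Real.pi / 4 with hb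
  let Λ : L2 →L[ℂ] (Fin 4 → ℂ) :=
    (ContinuousLinearMap.pi ![ℓ b, ℓ (-b), ℓ' b, ℓ' (-b)]).comp
      (Lp.fourierTransformₗᵢ ℝ ℂ).symm.toContinuousLinearEquiv.toContinuousLinearMap
  have hker : (Λ : L2 →ₗ[ℂ] (Fin 4 → ℂ)).ker ≤ (LSub z).range := by
    intro g hg
    set h : L2 := 𝓕⁻ g with hh
    have hΛ : Λ g = 0 := hg
    have v1 : resolventFun z h b = 0 := by rw [← hℓ]; exact congrFun hΛ 0
    have v2 : resolventFun z h (-b) = 0 := by rw [← hℓ]; exact congrFun hΛ 1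
    have v3 : deriv (resolventFun z h) b = 0 := by rw [← hℓ']; exact congrFun hΛ 2
    have v4 : deriv (resolventFun z h) (-b) = 0 := by rw [← hℓ']; exact congrFun hΛ 3
    have hv := contDiff_resolventFun hz h
    refine mem_range_LSub hv (fourier_ae_eq_resolventFun hz h) fun φ hφ hc => ?_
    have hd : ∀ x, resolventFun z h x = 0 → deriv (resolventFun z h) x = 0 →
        deriv (fun y => resolventFun z h y * φ y) x = 0 := by
      intro x h0 h1
      rw [deriv_fun_mul (hv.differentiable (by norm_num) x)
        (hφ.differentiable (by simp) x), h0, h1]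
      ring
    have hg' : (𝓕 h : L2) = g := FourierTransform.fourier_fourierInv_eq g
    rw [← hg', ← fourthDeriv_resolventFun hz h hφ hc]
    simp only [formalL, Pi.add_apply, mulFun, qs_apply, diracDeriv, dirac]
    rw [← hb, hd b v1 v3, hd (-b) v2 v4, v1, v2]
    ring
  have := Submodule.comap_map_eq_self hker
  rw [← this]
  exact (Submodule.closed_of_finiteDimensional
    ((LSub z).range.map (Λ : L2 →ₗ[ℂ] (Fin 4 → ℂ)))).preimage Λ.continuous

end Symbol

theorem mulFun_qs_eq_zero {v φ : ℝ → ℂ}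
    (h : ∀ x, |x| = 3 * Real.pi / 4 → (fun y => v y * φ y) =ᶠ[𝓝 x] fun _ => 0) :
    mulFun qs v φ = 0 := by
  have hb : (0 : ℝ) < 3 * Real.pi / 4 := by have := Real.pi_pos; positivity
  have h1 := h (3 * Real.pi / 4) (abs_of_pos hb)
  have h2 := h (-(3 * Real.pi / 4)) (by rw [abs_neg, abs_of_pos hb])
  simp only [mulFun, qs_apply, diracDeriv, dirac]
  have e1 : v _ * φ _ = 0 := h1.self_of_nhds
  have e2 : v _ * φ _ = 0 := h2.self_of_nhds
  rw [h1.deriv_eq, h2.deriv_eq, e1, e2]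
  simp

theorem eventuallyEq_zero_of_tsupport_subset {φ : ℝ → ℂ}
    (hs : tsupport φ ⊆ Ioi (3 * Real.pi / 4)) {x : ℝ} (hx : |x| = 3 * Real.pi / 4) :
    φ =ᶠ[𝓝 x] fun _ => 0 := by
  refine notMem_tsupport_iff_eventuallyEq.1 fun hmem => ?_
  have h1 := mem_Ioi.1 (hs hmem)
  exact absurd (le_abs_self x) (by rw [hx]; exact not_le.2 h1)

theorem integral_mul_iteratedDeriv {u φ : ℝ → ℂ} (hu : ContDiff ℝ ∞ u) (hφ : ContDiff ℝ ∞ φ)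
    (hc : HasCompactSupport u) (n : ℕ) :
    ∫ x, u x * iteratedDeriv n φ x = (-1) ^ n * ∫ x, iteratedDeriv n u x * φ x := by
  suffices H : ∀ k, ∫ x, iteratedDeriv k u x * iteratedDeriv n φ x
      = (-1) ^ n * ∫ x, iteratedDeriv (k + n) u x * φ x by simpa using H 0
  have hi : ∀ k m, Integrable (iteratedDeriv k u * iteratedDeriv m φ) := fun k m =>
    ((continuous_iteratedDeriv hu k).mul
      (continuous_iteratedDeriv hφ m)).integrable_of_hasCompactSupport
      (hasCompactSupport_iteratedDeriv hc k).mul_right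
  induction n with
  | zero => intro k; simp
  | succ n ih =>
    intro k
    rw [integral_mul_deriv_eq_deriv_mul_of_integrable
      (fun x _ => hasDerivAt_iteratedDeriv hu k x) (fun x _ => hasDerivAt_iteratedDeriv hφ n x)
      (hi _ _) (hi _ _) (hi _ _), ih (k + 1), show k + 1 + n = k + (n + 1) by ring]
    ring

/-- The differential expression `φ'''' - r φ`. -/
def fourthSub (r : ℝ) (φ : ℝ → ℂ) (x : ℝ) : ℂ := iteratedDeriv 4 φ x - r * φ x

theorem continuous_fourthSub (r : ℝ) {φ : ℝ → ℂ} (hφ : ContDiff ℝ ∞ φ) :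
    Continuous (fourthSub r φ) :=
  (continuous_fourth hφ).sub (continuous_const.mul hφ.continuous)

theorem memLp_fourthSub (r : ℝ) {φ : ℝ → ℂ} (hφ : ContDiff ℝ ∞ φ) (hc : HasCompactSupport φ) :
    MemLp (fourthSub r φ) 2 (volume : Measure ℝ) :=
  (continuous_fourthSub r hφ).memLp_of_hasCompactSupport
    ((hasCompactSupport_fourth hc).sub hc.mul_left)

theorem fourthSub_mem_range (r : ℝ) {u : ℝ → ℂ} (hu : ContDiff ℝ ∞ u) (hc : HasCompactSupport u)
    (hs : tsupport u ⊆ Ioi (3 * Real.pi / 4)) :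
    (memLp_fourthSub r hu hc).toLp _ ∈ (LSub r).range := by
  have hm : MemLp u 2 (volume : Measure ℝ) := hu.continuous.memLp_of_hasCompactSupport hc
  refine mem_range_LSub (hu.of_le (by simp)) hm.coeFn_toLp fun φ hφ hφc => ?_
  have h0 : mulFun qs u φ = 0 := mulFun_qs_eq_zero fun x hx => by
    filter_upwards [eventuallyEq_zero_of_tsupport_subset hs hx] with y hy
    rw [hy, zero_mul]
  have h1 : ∫ x, ((memLp_fourthSub r hu hc).toLp _ : L2) x * φ x
      = (∫ x, iteratedDeriv 4 u x * φ x) - r * ∫ x, u x * φ x := by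
    rw [← integral_const_mul, ← integral_sub
      (integrable_mul_test (continuous_fourth hu).locallyIntegrable hφ.continuous hφc)
      ((integrable_mul_test hu.continuous.locallyIntegrable hφ.continuous hφc).const_mul _)]
    refine integral_congr_ae ?_
    filter_upwards [(memLp_fourthSub r hu hc).coeFn_toLp] with x hx
    rw [hx, fourthSub]
    ring
  rw [formalL, Pi.add_apply, h0, h1, fourthDeriv, integral_mul_iteratedDeriv hu hφ hc]
  ring

theorem norm_integral_mul_le {g k : ℝ → ℂ} (hg : MemLp g 2 (volume : Measure ℝ))
    (hk : MemLp k 2 (volume : Measure ℝ)) :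
    ‖∫ x, g x * k x‖ ≤ ‖hg.toLp g‖ * ‖hk.toLp k‖ := by
  have h1 : ∫ x, g x * k x = inner ℂ (hg.star.toLp _) (hk.toLp k) := by
    rw [L2.inner_def]
    refine integral_congr_ae ?_
    filter_upwards [hg.star.coeFn_toLp, hk.coeFn_toLp] with x h1 h2
    rw [h1, h2]
    simp [mul_comm]
  have h2 : ‖hg.star.toLp (star g)‖ = ‖hg.toLp g‖ := by
    rw [Lp.norm_toLp, Lp.norm_toLp]
    congr 1
    exact eLpNorm_congr_norm_ae (Eventually.of_forall fun x => by simp)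
  rw [h1, ← h2]
  exact norm_inner_le_norm _ _

theorem norm_toLp_coe (g : L2) (h : MemLp (g : ℝ → ℂ) 2 (volume : Measure ℝ)) :
    ‖h.toLp g‖ = ‖g‖ := by rw [Lp.toLp_coeFn]

/-- If `(L - r) u = g`, then the pairing of `g` with a test function supported to the right of the
singularities is controlled by `φ'''' - r φ`. -/
theorem norm_integral_le_of_mem_range {r : ℝ} {g : L2} (hg : g ∈ (LSub r).range) :
    ∃ C : ℝ, ∀ (φ : ℝ → ℂ) (hφ : ContDiff ℝ ∞ φ) (hc : HasCompactSupport φ),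
      tsupport φ ⊆ Ioi (3 * Real.pi / 4) →
      ‖∫ x, φ x * g x‖ ≤ C * ‖(memLp_fourthSub r hφ hc).toLp _‖ := by
  obtain ⟨u, rfl⟩ := hg
  obtain ⟨v, hv, hu, he⟩ := (mem_graph_L _).1 (L.mem_graph u)
  refine ⟨‖(u : L2)‖, fun φ hφ hc hs => ?_⟩
  have h0 : mulFun qs v φ = 0 := mulFun_qs_eq_zero fun x hx => by
    filter_upwards [eventuallyEq_zero_of_tsupport_subset hs hx] with y hy
    rw [hy, mul_zero]
  have h1 := he φ hφ hc
  rw [formalL, Pi.add_apply, h0, add_zero, fourthDeriv, ofFun] at h1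
  have hvl : LocallyIntegrable v := hv.continuous.locallyIntegrable
  have i4 := integrable_mul_test hvl (continuous_fourth hφ) (hasCompactSupport_fourth hc)
  have i0 := integrable_mul_test hvl hφ.continuous hc
  have h2 : ∫ x, φ x * (LSub r u : L2) x
      = ∫ x, (u : L2) x * fourthSub r φ x := by
    have e1 : ∫ x, φ x * (LSub r u : L2) x = ∫ x, ((L u : L2) x * φ x - r * (v x * φ x)) := by
      refine integral_congr_ae ?_
      filter_upwards [Lp.coeFn_sub (L u) ((r : ℂ) • (u : L2)), Lp.coeFn_smul (r : ℂ) (u : L2), hu]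
        with x h1 h2 h3
      change φ x * ((L u - (r : ℂ) • (u : L2) : L2) : ℝ → ℂ) x = _
      rw [h1, Pi.sub_apply, h2, Pi.smul_apply, h3, smul_eq_mul]
      ring
    have e2 : ∫ x, (u : L2) x * fourthSub r φ x
        = ∫ x, (v x * iteratedDeriv 4 φ x - r * (v x * φ x)) := by
      refine integral_congr_ae ?_
      filter_upwards [hu] with x h3
      rw [h3, fourthSub]
      ring
    rw [e1, e2, integral_sub (integrable_mul_test (L2.locallyIntegrable _) hφ.continuous hc)
      (i0.const_mul _), integral_sub i4 (i0.const_mul _)]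
    exact congrArg₂ _ h1.symm rfl
  rw [h2]
  have := norm_integral_mul_le (Lp.memLp (u : L2)) (memLp_fourthSub r hφ hc)
  rwa [norm_toLp_coe] at this

/-- A closed range of `L - r` gives a uniform bound on test functions. -/
theorem exists_bound_of_isClosed {r : ℝ} (hcl : IsClosed ((LSub r).range : Set L2)) :
    ∃ M : ℝ, ∀ (φ u : ℝ → ℂ) (hφ : ContDiff ℝ ∞ φ) (hc : HasCompactSupport φ)
      (hu : ContDiff ℝ ∞ u) (huc : HasCompactSupport u),
      tsupport φ ⊆ Ioi (3 * Real.pi / 4) → tsupport u ⊆ Ioi (3 * Real.pi / 4) →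
      ‖∫ x, φ x * fourthSub r u x‖
        ≤ M * ‖(memLp_fourthSub r hφ hc).toLp _‖ * ‖(memLp_fourthSub r hu huc).toLp _‖ := by
  have : CompleteSpace (LSub r).range := hcl.completeSpace_coe
  let ι := {φ : ℝ → ℂ // ContDiff ℝ ∞ φ ∧ HasCompactSupport φ ∧
    tsupport φ ⊆ Ioi (3 * Real.pi / 4)}
  have hmem : ∀ φ : ι, MemLp φ.1 2 (volume : Measure ℝ) := fun φ =>
    φ.2.1.continuous.memLp_of_hasCompactSupport φ.2.2.1
  choose ℓ hℓ using fun φ : ι => exists_clm_eq_integral_mul (hmem φ)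
  let N : ι → ℝ := fun φ => ‖(memLp_fourthSub r φ.2.1 φ.2.2.1).toLp _‖
  let Λ : ι → (LSub r).range →L[ℂ] ℂ := fun φ =>
    ((N φ)⁻¹ : ℂ) • (ℓ φ).comp (LSub r).range.subtypeL
  obtain ⟨M, hM⟩ := banach_steinhaus (g := Λ) (by
    intro g
    obtain ⟨C, hC⟩ := norm_integral_le_of_mem_range g.2
    refine ⟨|C|, fun φ => ?_⟩
    have h1 := hC φ.1 φ.2.1 φ.2.2.1 φ.2.2.2
    have h2 : Λ φ g = ((N φ)⁻¹ : ℂ) * ∫ x, φ.1 x * (g : L2) x := by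
      rw [← hℓ φ]; rfl
    have hN : 0 ≤ N φ := norm_nonneg _
    rw [h2, norm_mul, norm_inv, Complex.norm_real, Real.norm_of_nonneg hN]
    rcases hN.eq_or_lt with h | h
    · rw [← h]; simp
    · rw [inv_mul_le_iff₀ h, mul_comm (N φ)]
      exact h1.trans (mul_le_mul_of_nonneg_right (le_abs_self C) hN))
  refine ⟨M, fun φ u hφ hc hu huc hs hsu => ?_⟩
  set g : L2 := (memLp_fourthSub r hu huc).toLp _ with hgdef
  have hg : g ∈ (LSub r).range := fourthSub_mem_range r hu huc hsu
  let φ' : ι := ⟨φ, hφ, hc, hs⟩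
  have h2 : Λ φ' ⟨g, hg⟩ = ((N φ')⁻¹ : ℂ) * ∫ x, φ x * g x := by
    rw [← hℓ φ']; rfl
  have h3 : ∫ x, φ x * fourthSub r u x = ∫ x, φ x * g x := by
    refine integral_congr_ae ?_
    filter_upwards [(memLp_fourthSub r hu huc).coeFn_toLp] with x hx
    rw [hx]
  have hN : 0 ≤ N φ' := norm_nonneg _
  rw [h3]
  change _ ≤ M * N φ' * ‖g‖
  rcases hN.eq_or_lt with h | h
  · obtain ⟨C, hC⟩ := norm_integral_le_of_mem_range hg
    have h1 : _ ≤ C * N φ' := hC φ hφ hc hs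
    rw [← h] at h1 ⊢
    simpa using h1
  · have h4 := (Λ φ').le_of_opNorm_le (hM φ') ⟨g, hg⟩
    rw [h2, norm_mul, norm_inv, Complex.norm_real, Real.norm_of_nonneg hN,
      inv_mul_le_iff₀ h] at h4
    calc _ ≤ _ := h4
      _ = M * N φ' * ‖g‖ := by rw [← mul_assoc, mul_comm (N φ')]; rfl

/-- `e^{iκx} χ(x/n)`. -/
def wavePacket (χ : ℝ → ℝ) (κ : ℝ) (n : ℕ) (x : ℝ) : ℂ :=
  Complex.exp (κ * Complex.I * x) * (χ ((n : ℝ)⁻¹ * x) : ℂ)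

section WavePacket

variable {χ : ℝ → ℝ}

theorem contDiff_wavePacket (hχ : ContDiff ℝ ∞ χ) (κ : ℝ) (n : ℕ) :
    ContDiff ℝ ∞ (wavePacket χ κ n) := by
  refine ContDiff.mul ?_ ?_
  · exact Complex.contDiff_exp.comp (contDiff_const.mul Complex.ofRealCLM.contDiff)
  · exact Complex.ofRealCLM.contDiff.comp (hχ.comp (contDiff_const.mul contDiff_id))

theorem tsupport_wavePacket_subset (hs : tsupport χ ⊆ Icc 1 3) (κ : ℝ) {n : ℕ} (hn : 0 < n) :
    tsupport (wavePacket χ κ n) ⊆ Icc (n : ℝ) (3 * n) := by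
  refine closure_minimal (fun x hx => ?_) isClosed_Icc
  have hn0 : (0 : ℝ) < n := by exact_mod_cast hn
  have h1 : χ ((n : ℝ)⁻¹ * x) ≠ 0 := by
    intro h
    exact hx (by simp [wavePacket, h])
  have h2 := hs (subset_tsupport χ h1)
  rw [mem_Icc, inv_mul_eq_div, le_div_iff₀ hn0, div_le_iff₀ hn0, one_mul] at h2
  exact h2

theorem iteratedDeriv_cexp_ofReal (c : ℂ) (k : ℕ) :
    iteratedDeriv k (fun x : ℝ => Complex.exp (c * x))
      = fun x : ℝ => c ^ k * Complex.exp (c * x) := by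
  induction k with
  | zero => simp
  | succ k ih =>
    rw [iteratedDeriv_succ, ih]
    funext x
    have h1 : HasDerivAt (fun x : ℝ => c * (x : ℂ)) (c * 1) x :=
      (hasDerivAt_id x).ofReal_comp.const_mul c
    rw [(h1.cexp.const_mul (c ^ k)).deriv]
    ring

theorem iteratedDeriv_ofReal_comp_mul (hχ : ContDiff ℝ ∞ χ) (a : ℝ) (k : ℕ) :
    iteratedDeriv k (fun x : ℝ => (χ (a * x) : ℂ))
      = fun x : ℝ => ((a ^ k * iteratedDeriv k χ (a * x) : ℝ) : ℂ) := by
  induction k with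
  | zero => simp
  | succ k ih =>
    rw [iteratedDeriv_succ, ih]
    funext x
    have h0 : HasDerivAt (iteratedDeriv k χ) (iteratedDeriv (k + 1) χ (a * x)) (a * x) := by
      rw [iteratedDeriv_succ]
      exact ((hχ.differentiable_iteratedDeriv k
        (WithTop.coe_lt_coe.2 (ENat.natCast_lt_top k))) _).hasDerivAt
    have h1 := ((h0.comp x ((hasDerivAt_id x).const_mul a)).const_mul (a ^ k)).ofReal_comp
    refine h1.deriv.trans ?_
    congr 1
    ring

/-- The profile bounding the error of a wave packet. -/
def profile (χ : ℝ → ℝ) (κ y : ℝ) : ℝ :=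
  4 * |κ| ^ 3 * |iteratedDeriv 1 χ y| + 6 * |κ| ^ 2 * |iteratedDeriv 2 χ y|
    + 4 * |κ| * |iteratedDeriv 3 χ y| + |iteratedDeriv 4 χ y|

theorem norm_fourthSub_wavePacket_le (hχ : ContDiff ℝ ∞ χ) (κ : ℝ) {n : ℕ} (hn : 0 < n) (x : ℝ) :
    ‖fourthSub (κ ^ 4) (wavePacket χ κ n) x‖ ≤ (n : ℝ)⁻¹ * profile χ κ ((n : ℝ)⁻¹ * x) := by
  set a : ℝ := (n : ℝ)⁻¹ with ha
  have hn1 : (1 : ℝ) ≤ n := by exact_mod_cast hn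
  have ha0 : 0 ≤ a := by positivity
  have ha1 : a ≤ 1 := inv_le_one_of_one_le₀ hn1
  have hcexp : ContDiff ℝ ∞ fun x : ℝ => Complex.exp (κ * Complex.I * x) :=
    Complex.contDiff_exp.comp (contDiff_const.mul Complex.ofRealCLM.contDiff)
  have hcχ : ContDiff ℝ ∞ fun x : ℝ => (χ (a * x) : ℂ) :=
    Complex.ofRealCLM.contDiff.comp (hχ.comp (contDiff_const.mul contDiff_id))
  have h4 : ((4 : ℕ) : WithTop ℕ∞) ≤ ∞ := WithTop.coe_le_coe.2 le_top
  set E : ℂ := Complex.exp (κ * Complex.I * x) with hE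
  have hEn : ‖E‖ = 1 := by
    rw [hE, show (κ : ℂ) * Complex.I * x = ((κ * x : ℝ) : ℂ) * Complex.I by push_cast; ring,
      Complex.norm_exp_ofReal_mul_I]
  have key : fourthSub (κ ^ 4) (wavePacket χ κ n) x
      = E * (4 * (κ * Complex.I) ^ 3 * (a ^ 1 * iteratedDeriv 1 χ (a * x) : ℝ)
        + 6 * (κ * Complex.I) ^ 2 * (a ^ 2 * iteratedDeriv 2 χ (a * x) : ℝ)
        + 4 * (κ * Complex.I) * (a ^ 3 * iteratedDeriv 3 χ (a * x) : ℝ)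
        + (a ^ 4 * iteratedDeriv 4 χ (a * x) : ℝ)) := by
    have hw : wavePacket χ κ n = fun x : ℝ => Complex.exp (κ * Complex.I * x) * (χ (a * x) : ℂ) :=
      rfl
    rw [fourthSub, hw, iteratedDeriv_fun_mul (hcexp.contDiffAt.of_le h4)
      (hcχ.contDiffAt.of_le h4)]
    simp only [iteratedDeriv_cexp_ofReal, iteratedDeriv_ofReal_comp_mul hχ, Finset.sum_range_succ,
      Finset.sum_range_zero, ← hE]
    norm_num [Nat.choose]
    linear_combination (κ : ℂ) ^ 4 * E * (χ (a * x) : ℂ) * Complex.I_pow_four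
  have hpow : ∀ k : ℕ, 1 ≤ k → ∀ y : ℝ, ‖((a ^ k * y : ℝ) : ℂ)‖ ≤ a * |y| := by
    intro k hk y
    rw [Complex.norm_real, Real.norm_eq_abs, abs_mul, abs_of_nonneg (by positivity : 0 ≤ a ^ k)]
    refine mul_le_mul_of_nonneg_right ?_ (abs_nonneg y)
    simpa using pow_le_pow_of_le_one ha0 ha1 hk
  have hκ : ‖(κ : ℂ) * Complex.I‖ = |κ| := by simp
  rw [key, norm_mul, hEn, one_mul, profile]
  refine (norm_add_le _ _).trans ?_
  refine (add_le_add_left ((norm_add_le _ _).trans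
    (add_le_add_left (norm_add_le _ _) _)) _).trans ?_
  simp only [norm_mul (4 * ((κ : ℂ) * Complex.I) ^ 3), norm_mul (6 * ((κ : ℂ) * Complex.I) ^ 2),
    norm_mul (4 * ((κ : ℂ) * Complex.I)), norm_mul (4 : ℂ), norm_mul (6 : ℂ), norm_pow, hκ]
  have k1 := mul_le_mul_of_nonneg_left (hpow 1 le_rfl (iteratedDeriv 1 χ (a * x)))
    (by positivity : 0 ≤ 4 * |κ| ^ 3)
  have k2 := mul_le_mul_of_nonneg_left (hpow 2 (by norm_num) (iteratedDeriv 2 χ (a * x)))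
    (by positivity : 0 ≤ 6 * |κ| ^ 2)
  have k3 := mul_le_mul_of_nonneg_left (hpow 3 (by norm_num) (iteratedDeriv 3 χ (a * x)))
    (by positivity : 0 ≤ 4 * |κ|)
  have k4 := hpow 4 (by norm_num) (iteratedDeriv 4 χ (a * x))
  norm_num at k1 k2 k3 k4 ⊢
  linarith

theorem continuous_profile (hχ : ContDiff ℝ ∞ χ) (κ : ℝ) : Continuous (profile χ κ) := by
  have h : ∀ k : ℕ, Continuous (iteratedDeriv k χ) := fun k =>
    hχ.continuous_iteratedDeriv k (WithTop.coe_le_coe.2 le_top)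
  have := h 1
  have := h 2
  have := h 3
  have := h 4
  unfold profile
  fun_prop

theorem hasCompactSupport_profile (hc : HasCompactSupport χ) (κ : ℝ) :
    HasCompactSupport (profile χ κ) := by
  have h : ∀ k : ℕ, HasCompactSupport (iteratedDeriv k χ) := fun k => by
    induction k with
    | zero => simpa
    | succ n ih => rw [iteratedDeriv_succ]; exact ih.deriv
  have h' : ∀ k : ℕ, HasCompactSupport fun y => |iteratedDeriv k χ y| := fun k => (h k).norm
  exact (((h' 1).mul_left.add (h' 2).mul_left).add (h' 3).mul_left).add (h' 4)

theorem norm_toLp_sq {g : ℝ → ℂ} (hg : MemLp g 2 (volume : Measure ℝ)) :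
    ‖hg.toLp g‖ ^ 2 = ∫ x, ‖g x‖ ^ 2 := by
  rw [← inner_self_eq_norm_sq (𝕜 := ℂ), L2.inner_def, ← integral_re (L2.integrable_inner _ _)]
  refine integral_congr_ae ?_
  filter_upwards [hg.coeFn_toLp] with x hx
  rw [hx, inner_self_eq_norm_sq]

theorem integral_comp_inv_natCast_mul (F : ℝ → ℝ) {n : ℕ} :
    ∫ x, F ((n : ℝ)⁻¹ * x) = n * ∫ y, F y := by
  rw [Measure.integral_comp_mul_left, inv_inv, abs_of_nonneg (Nat.cast_nonneg n), smul_eq_mul]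

theorem norm_wavePacket (κ : ℝ) (n : ℕ) (x : ℝ) :
    ‖wavePacket χ κ n x‖ = |χ ((n : ℝ)⁻¹ * x)| := by
  rw [wavePacket, norm_mul, show (κ : ℂ) * Complex.I * x = ((κ * x : ℝ) : ℂ) * Complex.I by
    push_cast; ring, Complex.norm_exp_ofReal_mul_I, one_mul, Complex.norm_real, Real.norm_eq_abs]

theorem norm_toLp_wavePacket_sq {κ : ℝ} {n : ℕ}
    (h : MemLp (wavePacket χ κ n) 2 (volume : Measure ℝ)) :
    ‖h.toLp _‖ ^ 2 = n * ∫ y, χ y ^ 2 := by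
  rw [norm_toLp_sq, ← integral_comp_inv_natCast_mul (fun y => χ y ^ 2)]
  simp only [norm_wavePacket, sq_abs]

theorem norm_toLp_fourthSub_wavePacket_sq_le (hχ : ContDiff ℝ ∞ χ) (hc : HasCompactSupport χ)
    {κ : ℝ} {n : ℕ} (hn : 0 < n)
    (h : MemLp (fourthSub (κ ^ 4) (wavePacket χ κ n)) 2 (volume : Measure ℝ)) :
    ‖h.toLp _‖ ^ 2 ≤ (∫ y, profile χ κ y ^ 2) / n := by
  have hn0 : (n : ℝ) ≠ 0 := by exact_mod_cast hn.ne'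
  have hp := continuous_profile hχ κ
  have hpi : Integrable fun y => profile χ κ y ^ 2 :=
    (hp.pow 2).integrable_of_hasCompactSupport <| by
      simpa only [sq] using! (hasCompactSupport_profile hc κ).mul_right
  have hpi' : Integrable fun x => ((n : ℝ)⁻¹) ^ 2 * profile χ κ ((n : ℝ)⁻¹ * x) ^ 2 :=
    (hpi.comp_mul_left' (inv_ne_zero hn0)).const_mul _
  rw [norm_toLp_sq]
  calc _ ≤ ∫ x, ((n : ℝ)⁻¹) ^ 2 * profile χ κ ((n : ℝ)⁻¹ * x) ^ 2 := by
        refine integral_mono ((memLp_two_iff_integrable_sq_norm h.1).1 h) hpi' fun x => ?_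
        change ‖fourthSub (κ ^ 4) (wavePacket χ κ n) x‖ ^ 2 ≤ _
        rw [← mul_pow]
        exact pow_le_pow_left₀ (norm_nonneg _) (norm_fourthSub_wavePacket_le hχ κ hn x) 2
    _ = _ := by
        rw [integral_const_mul, integral_comp_inv_natCast_mul (fun y => profile χ κ y ^ 2)]
        field_simp

theorem integral_wavePacket_neg_mul (κ : ℝ) (n : ℕ) :
    ∫ x, wavePacket χ (-κ) n x * wavePacket χ κ n x = ((n * ∫ y, χ y ^ 2 : ℝ) : ℂ) := by
  rw [← integral_comp_inv_natCast_mul (fun y => χ y ^ 2), ← integral_complex_ofReal]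
  congr 1
  funext x
  have : Complex.exp (((-κ : ℝ) : ℂ) * Complex.I * x) * Complex.exp (κ * Complex.I * x) = 1 := by
    rw [← Complex.exp_add, Complex.ofReal_neg, neg_mul, neg_mul, neg_add_cancel, Complex.exp_zero]
  rw [wavePacket, wavePacket, mul_mul_mul_comm, this]
  push_cast
  ring

end WavePacket

theorem fourthSub_eq_add (r ε : ℝ) (φ : ℝ → ℂ) :
    fourthSub r φ = fun x => fourthSub (r + ε) φ x + ε * φ x := by
  funext x
  simp only [fourthSub]
  push_cast
  ring

theorem norm_toLp_fourthSub_le {r ε : ℝ} (hε : 0 ≤ ε) {φ : ℝ → ℂ} (hφ : ContDiff ℝ ∞ φ)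
    (hc : HasCompactSupport φ) :
    ‖(memLp_fourthSub r hφ hc).toLp _‖ ≤ ‖(memLp_fourthSub (r + ε) hφ hc).toLp _‖
      + ε * ‖(hφ.continuous.memLp_of_hasCompactSupport (p := 2) (μ := (volume : Measure ℝ)) hc).toLp
        φ‖ := by
  have hm := hφ.continuous.memLp_of_hasCompactSupport (p := 2) (μ := (volume : Measure ℝ)) hc
  have : (memLp_fourthSub r hφ hc).toLp _ = (memLp_fourthSub (r + ε) hφ hc).toLp _
      + (ε : ℂ) • hm.toLp φ := by
    rw [← MemLp.toLp_const_smul, ← MemLp.toLp_add]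
    congr 1
    exact fourthSub_eq_add r ε φ
  rw [this]
  refine (norm_add_le _ _).trans ?_
  rw [norm_smul, Complex.norm_real, Real.norm_of_nonneg hε]

/-- On `[0, ∞)` the range of `L - r` is not closed. -/
theorem not_isClosed_range_LSub {r : ℝ} (hr : 0 ≤ r) : ¬ IsClosed ((LSub r).range : Set L2) := by
  intro hcl
  obtain ⟨M, hM⟩ := exists_bound_of_isClosed hcl
  let χ : ContDiffBump (2 : ℝ) := ⟨1 / 2, 1, by norm_num, by norm_num⟩
  have hχ : ContDiff ℝ ∞ χ := χ.contDiff
  have hχc : HasCompactSupport χ := χ.hasCompactSupport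
  have hχs : tsupport χ ⊆ Icc 1 3 := by
    rw [χ.tsupport_eq, Real.closedBall_eq_Icc]
    change Icc (2 - 1) (2 + 1) ⊆ _
    norm_num
  set S : ℝ := ∫ y, χ y ^ 2 with hS
  have hS0 : 0 < S := by
    refine Continuous.integral_pos_of_hasCompactSupport_nonneg_nonzero (x := 2)
      (hχ.continuous.pow 2) ?_ (fun y => sq_nonneg _) ?_
    · simpa only [sq] using! hχc.mul_right
    · rw [χ.one_of_mem_closedBall]
      · norm_num
      · exact Metric.mem_closedBall_self (by norm_num [χ])
  set ε : ℝ := 1 / (4 * (|M| + 1)) with hεdef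
  have hε : 0 < ε := by positivity
  have hMε : |M| * ε ≤ 1 / 4 := by
    rw [hεdef, mul_one_div, div_le_div_iff₀ (by positivity) (by norm_num)]
    linarith
  set κ : ℝ := √√(r + ε) with hκ
  have hκ4 : κ ^ 4 = r + ε := by
    rw [show κ ^ 4 = (κ ^ 2) ^ 2 by ring, hκ, Real.sq_sqrt (Real.sqrt_nonneg _),
      Real.sq_sqrt (by linarith)]
  set T : ℝ := ∫ y, profile χ κ y ^ 2 with hT
  have hT0 : 0 ≤ T := integral_nonneg fun y => sq_nonneg _
  obtain ⟨n, hn⟩ := exists_nat_gt (max (3 * Real.pi / 4)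
    ((√(S * T) + 2 * |M| * T) / (ε / 2 * S)))
  obtain ⟨hn1, hn2⟩ := max_lt_iff.1 hn
  have hpi := Real.pi_gt_three
  have hn0 : (0 : ℝ) < n := by linarith
  have hnN : 0 < n := by exact_mod_cast hn0
  have hn11 : (1 : ℝ) ≤ n := by exact_mod_cast hnN
  have hdata : ∀ k : ℝ, k ^ 4 = r + ε → |k| = |κ| →
      ∃ (h : ContDiff ℝ ∞ (wavePacket χ k n)) (hc : HasCompactSupport (wavePacket χ k n)),
        tsupport (wavePacket χ k n) ⊆ Ioi (3 * Real.pi / 4) ∧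
        ‖(memLp_fourthSub (r + ε) h hc).toLp _‖ ^ 2 ≤ T / n ∧
        ‖(memLp_fourthSub r h hc).toLp _‖ ^ 2 ≤ 2 * (T / n + ε ^ 2 * (n * S)) := by
    intro k hk hkκ
    have h := contDiff_wavePacket hχ k n
    have hs := tsupport_wavePacket_subset hχs k hnN
    have hc : HasCompactSupport (wavePacket χ k n) :=
      isCompact_Icc.of_isClosed_subset (isClosed_tsupport _) hs
    have hpr : profile χ k = profile χ κ := by
      funext y
      simp only [profile, hkκ]
    have h1 : ‖(memLp_fourthSub (r + ε) h hc).toLp _‖ ^ 2 ≤ T / n := by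
      have h1 := norm_toLp_fourthSub_wavePacket_sq_le hχ hχc hnN (memLp_fourthSub (k ^ 4) h hc)
      rw [hpr] at h1
      simpa only [hk] using h1
    have h2 := norm_toLp_fourthSub_le (r := r) hε.le h hc
    have h3 := norm_toLp_wavePacket_sq
      (h.continuous.memLp_of_hasCompactSupport (p := 2) (μ := (volume : Measure ℝ)) hc)
    refine ⟨h, hc, hs.trans fun x hx => hn1.trans_le hx.1, h1, ?_⟩
    calc _ ≤ _ := pow_le_pow_left₀ (norm_nonneg _) h2 2
      _ ≤ _ := add_sq_le
      _ ≤ _ := by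
        rw [mul_pow, h3]
        gcongr
  obtain ⟨hu, huc, hus, hu1, hu2⟩ := hdata κ hκ4 rfl
  obtain ⟨hφ, hc, hφs, -, hφ2⟩ := hdata (-κ) (by rw [← hκ4]; ring) (abs_neg κ)
  have hmain := hM _ _ hφ hc hu huc hφs hus
  have hφm := hφ.continuous.memLp_of_hasCompactSupport (p := 2) (μ := (volume : Measure ℝ)) hc
  have hφn := norm_toLp_wavePacket_sq hφm
  -- the left-hand side
  have hsplit : ∫ x, wavePacket χ (-κ) n x * fourthSub r (wavePacket χ κ n) x
      = (∫ x, wavePacket χ (-κ) n x * fourthSub (r + ε) (wavePacket χ κ n) x)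
        + ((ε * (n * S) : ℝ) : ℂ) := by
    rw [Complex.ofReal_mul, ← integral_wavePacket_neg_mul, ← integral_const_mul, ← integral_add]
    · congr 1
      funext x
      rw [fourthSub_eq_add r ε]
      ring
    · exact hφm.integrable_mul (memLp_fourthSub (r + ε) hu huc)
    · exact (hφm.integrable_mul
        (hu.continuous.memLp_of_hasCompactSupport (p := 2) huc)).const_mul _
  have herr : ‖∫ x, wavePacket χ (-κ) n x * fourthSub (r + ε) (wavePacket χ κ n) x‖
      ≤ √(S * T) := by
    refine (norm_integral_mul_le hφm (memLp_fourthSub (r + ε) hu huc)).trans ?_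
    refine Real.le_sqrt_of_sq_le ?_
    rw [mul_pow, hφn]
    calc _ ≤ n * S * (T / n) := mul_le_mul_of_nonneg_left hu1 (by positivity)
      _ = S * T := by field_simp
  have hlow : ε * (n * S) - √(S * T)
      ≤ ‖∫ x, wavePacket χ (-κ) n x * fourthSub r (wavePacket χ κ n) x‖ := by
    rw [hsplit]
    have := norm_sub_norm_le ((ε * (n * S) : ℝ) : ℂ)
      (-∫ x, wavePacket χ (-κ) n x * fourthSub (r + ε) (wavePacket χ κ n) x)
    rw [norm_neg, sub_neg_eq_add, add_comm ((ε * (n * S) : ℝ) : ℂ), Complex.norm_real,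
      Real.norm_of_nonneg (by positivity)] at this
    linarith
  -- the right-hand side
  set A := ‖(memLp_fourthSub r hφ hc).toLp _‖
  set B := ‖(memLp_fourthSub r hu huc).toLp _‖
  have hTn : T / n ≤ T := div_le_self hT0 hn11
  have hAB : A * B ≤ 2 * (T + ε ^ 2 * (n * S)) := by linarith [two_mul_le_add_sq A B]
  have hup : M * A * B ≤ 2 * |M| * T + ε / 2 * (n * S) := by
    have hA : 0 ≤ A * B := mul_nonneg (norm_nonneg _) (norm_nonneg _)
    calc M * A * B = M * (A * B) := mul_assoc _ _ _
      _ ≤ |M| * (A * B) := mul_le_mul_of_nonneg_right (le_abs_self M) hA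
      _ ≤ |M| * (2 * (T + ε ^ 2 * (n * S))) := by gcongr
      _ = 2 * |M| * T + 2 * (|M| * ε) * (ε * (n * S)) := by ring
      _ ≤ 2 * |M| * T + 2 * (1 / 4) * (ε * (n * S)) := by gcongr
      _ = _ := by ring
  rw [div_lt_iff₀ (by positivity)] at hn2
  linarith

theorem continuousSpectrum_L :
    continuousSpectrum L = (fun r : ℝ => (r : ℂ)) '' Set.Ici 0 := by
  ext z
  change ¬ IsClosed ((LSub z).range : Set L2) ↔ _
  refine ⟨fun h => ?_, ?_⟩
  · by_contra hz
    exact h (isClosed_range_LSub fun r hr h => hz ⟨r, hr, h⟩)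
  · rintro ⟨r, hr, rfl⟩
    exact not_isClosed_range_LSub hr

end EmbeddedEigenvalue

end

theorem mainTheorem3 :
    ContDiffOn ℝ 1 EmbeddedEigenvalue.theta (Set.Ici 0) ∧
    ContDiff ℝ 1 EmbeddedEigenvalue.f ∧
    EmbeddedEigenvalue.DistEq
      (EmbeddedEigenvalue.fourthDeriv EmbeddedEigenvalue.fC
        + EmbeddedEigenvalue.mulFun EmbeddedEigenvalue.qs EmbeddedEigenvalue.fC)
      (EmbeddedEigenvalue.ofFun EmbeddedEigenvalue.fC) ∧
    (∃ hf : MemLp EmbeddedEigenvalue.fC 2 (volume : Measure ℝ),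
      EmbeddedEigenvalue.IsEigenvector EmbeddedEigenvalue.L 1 (hf.toLp EmbeddedEigenvalue.fC)) ∧
    EmbeddedEigenvalue.continuousSpectrum EmbeddedEigenvalue.L
      = (fun r : ℝ => (r : ℂ)) '' Set.Ici 0 ∧
    EmbeddedEigenvalue.IsEmbeddedEigenvalue EmbeddedEigenvalue.L 1 := by
  refine ⟨EmbeddedEigenvalue.contDiff_theta.contDiffOn, EmbeddedEigenvalue.contDiff_f,
    EmbeddedEigenvalue.formalL_fC,
    ⟨EmbeddedEigenvalue.memLp_fC, EmbeddedEigenvalue.isEigenvector_fC⟩,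
    EmbeddedEigenvalue.continuousSpectrum_L, ⟨_, EmbeddedEigenvalue.isEigenvector_fC⟩, ?_⟩
  rw [EmbeddedEigenvalue.continuousSpectrum_L]
  exact ⟨1, Set.mem_Ici.2 zero_le_one, Complex.ofReal_one⟩
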